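/- **Setting.** A partition of $[0,\infty)$ is a set $\mathbb T=\{t_0,t_1,\dots\}$ with $0=t_0<t_1<\cdots$ and $t_k\to\infty$; $s'$ denotes the successor of $s\in\mathbb T$. Fix a sequence of partitions $\mathbb T_1\subset\mathbb T_2\subset\cdots$ of $[0,\infty)$ whose meshes $\sup_k|t_{k+1}-t_k|$ tend to $0$. A continuous $X:[0,\infty)\to\mathbb R$ belongs to $QV$ if $\langle X\rangle_t:=\lim_n\sum_{s\in\mathbb T_n,\,s'\le t}(X_{s'}-X_s)^2$ exists for every $t\ge0$ and is continuous in $t$. A continuous $\boldsymbol X:[0,\infty)\to\mathbb R^d$ belongs to $QV^d$ if $X^i+X^j\in QV$ for all $i,j$. A function $\boldsymbol\xi:[0,\infty)\to\mathbb R^d$ is an admissible integrand for $\boldsymbol X\in QV^d$ if for every $T>0$ there are $n\in\mathbb N$, open sets $U\subset\mathbb R^d$ and $W\subset\mathbb R^n$, a function $f\in C^{2,1}(U,W)$ (that is, $f(\boldsymbol x,\boldsymbol a)$ is continuously differentiable on $U\times W$ and twice differentiable in $\boldsymbol x$ with second $\boldsymbol x$-derivatives continuous on $U\times W$), and a continuous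 $\boldsymbol A:[0,T]\to W$ of bounded variation such that $\boldsymbol X_t\in U$ and $\boldsymbol\xi_t=\nabla_{\boldsymbol x}f(\boldsymbol X_t,\boldsymbol A_t)$ for $0\le t\le T$. The Föllmer integral is $\int_0^t\boldsymbol\xi_s\,d\boldsymbol X_s:=\lim_n\sum_{s\in\mathbb T_n,\,s'\le t}\boldsymbol\xi_s\cdot(\boldsymbol X_{s'}-\boldsymbol X_s)$. For $X\in QV$ let $\mathcal E(X)_t:=\exp(X_t-\tfrac12\langle X\rangle_t)$, and for $Y\in QV$ with $Y>0$ let $\mathscr L(Y)_t:=\log Y_t+\tfrac12\langle\log Y\rangle_t$; for vectors, $\mathscr L$ is taken componentwise. Let $\boldsymbol S=(S^1,\dots,S^d)\in QV^d$ with $S^i_t>0$ for all $i$ and $t$. A self-financing strategy is an admissible integrand $\boldsymbol\xi$ for $\boldsymbol S$ whose value process $V_t:=\boldsymbol\xi_t\cdot\boldsymbol S_t$ satisfies $V_t=V_0+\int_0^t\boldsymbol\xi_s\,d\boldsymbol S_s$ for all $t\ge0$. A portfolio strategy is an admissible integrand $\boldsymbol\pi$ for $\mathscr L(\boldsymbol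 S)$ with values in the simplex $\{\boldsymbol x\in\mathbb R^d: x^i\ge0,\ \sum_ix^i=1\}$; its portfolio value process is $V^{\boldsymbol\pi}_t:=\mathcal E\big(\int_0^\cdot\boldsymbol\pi_s\,d\mathscr L(\boldsymbol S)_s\big)_t$. **Proposition 2.1.** One has $\log S^i\in QV$ for every $i$ and $\mathscr L(\boldsymbol S)\in QV^d$. There is a one-to-one correspondence between all portfolio strategies $\boldsymbol\pi$ and all self-financing strategies $\boldsymbol\xi$ that satisfy $\xi^i_t\ge0$ for all $i,t$ and whose value process satisfies $V_0=1$ and $V_t>0$ for all $t$. With $\boldsymbol\pi_t/\boldsymbol S_t:=(\pi^1_t/S^1_t,\dots,\pi^d_t/S^d_t)$, it is given by the identity $$\frac{\boldsymbol\pi_t}{\boldsymbol S_t}=\frac{\boldsymbol\xi_t}{V_t},\qquad t\ge0.$$ In this case $\boldsymbol\pi/\boldsymbol S$ is an admissible integrand for $\boldsymbol S$, the Föllmer integrals $\int_0^t\boldsymbol\xi_s\,d\boldsymbol S_s$, $\int_0^t\boldsymbol\pi_s\,d\mathscr L(\boldsymbol S)_s$ and $\int_0^t\frac{\boldsymbol\pi_s}{\boldsymbol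 S_s}\,d\boldsymbol S_s$ exist for all $t\ge0$, the last two belong to $QV$ as functions of $t$, and $$V_t=V^{\boldsymbol\pi}_t=\mathcal E\Big(\int_0^\cdot\frac{\boldsymbol\pi_s}{\boldsymbol S_s}\,d\boldsymbol S_s\Big)_t,\qquad t\ge0.$$ -/

import Mathlib

open Filter Topology Set
open scoped NNReal ENNReal

noncomputable section

namespace PathwiseIto

/-- A partition `{t₀, t₁, …}` of the time axis `[0, ∞)`: `0 = t₀ < t₁ < ⋯` and `tₖ → ∞`.
It is given by its (unique) increasing enumeration; the successor of `time k` is `time (k + 1)`. -/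
structure Partition where
  time : ℕ → ℝ≥0
  time_zero : time 0 = 0
  strictMono : StrictMono time
  tendsto : Tendsto time atTop atTop

namespace Partition

/-- The set of time points of the partition. -/
def points (P : Partition) : Set ℝ≥0 := Set.range P.time

/-- The mesh `sup_k |t_{k+1} - t_k|`, possibly infinite. -/
def mesh (P : Partition) : ℝ≥0∞ := ⨆ k : ℕ, edist (P.time (k + 1)) (P.time k)

theorem finite_indices (P : Partition) (t : ℝ≥0) : {k : ℕ | P.time (k + 1) ≤ t}.Finite := by
  obtain ⟨N, hN⟩ := (P.tendsto.eventually (eventually_gt_atTop t)).exists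
  refine (Set.finite_lt_nat N).subset fun k hk => ?_
  by_contra h
  have h1 : P.time N ≤ P.time (k + 1) :=
    P.strictMono.monotone ((not_lt.mp h).trans (Nat.le_succ k))
  exact absurd (hN.trans_le h1) (not_lt.mpr hk)

/-- The finitely many indices `k` of points `s = t_k` whose successor `s' = t_{k+1}`
satisfies `s' ≤ t`. -/
def indices (P : Partition) (t : ℝ≥0) : Finset ℕ := (P.finite_indices t).toFinset

end Partition

/-- A refining sequence of partitions of `[0, ∞)`: the partitions are nested and the mesh tends
to zero. -/
structure RefiningSequence where
  part : ℕ → Partition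
  nested : ∀ n, (part n).points ⊆ (part (n + 1)).points
  mesh_tendsto : Tendsto (fun n => (part n).mesh) atTop (𝓝 0)

variable {d : ℕ}

/-- `∑_{s ∈ 𝕋ₙ, s' ≤ t} (X_{s'} - X_s)²`. -/
def squareSum (𝕋 : RefiningSequence) (X : ℝ≥0 → ℝ) (n : ℕ) (t : ℝ≥0) : ℝ :=
  ∑ k ∈ (𝕋.part n).indices t,
    (X ((𝕋.part n).time (k + 1)) - X ((𝕋.part n).time k)) ^ 2

/-- The quadratic variation `⟨X⟩_t` along the sequence of partitions. -/
def quadVar (𝕋 : RefiningSequence) (X : ℝ≥0 → ℝ) (t : ℝ≥0) : ℝ :=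
  limUnder atTop (fun n => squareSum 𝕋 X n t)

/-- `X ∈ QV`: `X` is continuous, the limit defining `⟨X⟩_t` exists for every `t`, and `⟨X⟩` is
continuous. -/
structure IsQV (𝕋 : RefiningSequence) (X : ℝ≥0 → ℝ) : Prop where
  continuous : Continuous X
  tendsto : ∀ t, Tendsto (fun n => squareSum 𝕋 X n t) atTop (𝓝 (quadVar 𝕋 X t))
  continuous_quadVar : Continuous (quadVar 𝕋 X)

/-- `X ∈ QV^d`: `X` is continuous and `X^i + X^j ∈ QV` for all `i, j`. -/
structure IsQVVec (𝕋 : RefiningSequence) (X : ℝ≥0 → Fin d → ℝ) : Prop where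
  continuous : Continuous X
  add : ∀ i j, IsQV 𝕋 (fun t => X t i + X t j)

/-- The gradient `∇ₓ f (x, a) = (f_{x^1}, …, f_{x^d})` with respect to the first variable. -/
def gradX {n : ℕ} (f : (Fin d → ℝ) × (Fin n → ℝ) → ℝ) (x : Fin d → ℝ) (a : Fin n → ℝ) :
    Fin d → ℝ :=
  fun i => fderiv ℝ (fun y => f (y, a)) x (Pi.single i 1)

/-- `f ∈ C^{2,1}(U, W)` (for open `U`, `W`): `f` is continuously differentiable in
`(x, a) ∈ U × W` and twice continuously differentiable in `x`, the second `x`-derivative being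
continuous in `(x, a) ∈ U × W`. -/
structure IsC21On {n : ℕ} (f : (Fin d → ℝ) × (Fin n → ℝ) → ℝ)
    (U : Set (Fin d → ℝ)) (W : Set (Fin n → ℝ)) : Prop where
  contDiffOn_one : ContDiffOn ℝ 1 f (U ×ˢ W)
  contDiffOn_two : ∀ a ∈ W, ContDiffOn ℝ 2 (fun x => f (x, a)) U
  continuousOn_second : ContinuousOn
    (fun p : (Fin d → ℝ) × (Fin n → ℝ) =>
      fderiv ℝ (fun x => fderiv ℝ (fun y => f (y, p.2)) x) p.1) (U ×ˢ W)

/-- `A ∈ CBV([0, T], W)`; only the values of `A` on `[0, T]` matter. -/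
structure IsCBVOn {n : ℕ} (A : ℝ≥0 → Fin n → ℝ) (T : ℝ≥0) (W : Set (Fin n → ℝ)) : Prop where
  mapsTo : MapsTo A (Icc 0 T) W
  continuousOn : ContinuousOn A (Icc 0 T)
  boundedVariation : BoundedVariationOn A (Icc 0 T)

/-- `ξ` is an admissible integrand for the trajectory `X`: on every `[0, T]` it is of the form
`ξ_t = ∇ₓ f (X_t, A_t)` with `f ∈ C^{2,1}(U, W)` and `A ∈ CBV([0, T], W)`. -/
def IsAdmissibleIntegrand (X ξ : ℝ≥0 → Fin d → ℝ) : Prop :=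
  ∀ T : ℝ≥0, 0 < T →
    ∃ (n : ℕ) (U : Set (Fin d → ℝ)) (W : Set (Fin n → ℝ))
      (f : (Fin d → ℝ) × (Fin n → ℝ) → ℝ) (A : ℝ≥0 → Fin n → ℝ),
      IsOpen U ∧ IsOpen W ∧ IsC21On f U W ∧ IsCBVOn A T W ∧
        ∀ t ∈ Icc 0 T, X t ∈ U ∧ ξ t = gradX f (X t) (A t)

/-- The nonanticipative Riemann sum `∑_{s ∈ 𝕋ₙ, s' ≤ t} ξ_s · (X_{s'} - X_s)`. -/
def riemannSum (𝕋 : RefiningSequence) (ξ X : ℝ≥0 → Fin d → ℝ) (n : ℕ) (t : ℝ≥0) : ℝ :=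
  ∑ k ∈ (𝕋.part n).indices t,
    ξ ((𝕋.part n).time k) ⬝ᵥ (X ((𝕋.part n).time (k + 1)) - X ((𝕋.part n).time k))

/-- The Föllmer integral `∫₀ᵗ ξ_s dX_s`. -/
def follmerIntegral (𝕋 : RefiningSequence) (ξ X : ℝ≥0 → Fin d → ℝ) (t : ℝ≥0) : ℝ :=
  limUnder atTop (fun n => riemannSum 𝕋 ξ X n t)

/-- The limit defining the Föllmer integral `∫₀ᵗ ξ_s dX_s` exists for every `t`. -/
def FollmerIntegralExists (𝕋 : RefiningSequence) (ξ X : ℝ≥0 → Fin d → ℝ) : Prop :=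
  ∀ t, Tendsto (fun n => riemannSum 𝕋 ξ X n t) atTop (𝓝 (follmerIntegral 𝕋 ξ X t))

/-- The Doléans-Dade exponential `ℰ(X)_t = exp (X_t - ⟨X⟩_t / 2)`. -/
def doleansDade (𝕋 : RefiningSequence) (X : ℝ≥0 → ℝ) (t : ℝ≥0) : ℝ :=
  Real.exp (X t - quadVar 𝕋 X t / 2)

/-- The Itô logarithm `ℒ(Y)_t = log Y_t + ⟨log Y⟩_t / 2` of a scalar trajectory. -/
def itoLog (𝕋 : RefiningSequence) (Y : ℝ≥0 → ℝ) (t : ℝ≥0) : ℝ :=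
  Real.log (Y t) + quadVar 𝕋 (fun s => Real.log (Y s)) t / 2

/-- The componentwise Itô logarithm `ℒ(Y) = (ℒ(Y^1), …, ℒ(Y^d))`. -/
def itoLogVec (𝕋 : RefiningSequence) (Y : ℝ≥0 → Fin d → ℝ) (t : ℝ≥0) : Fin d → ℝ :=
  fun i => itoLog 𝕋 (fun s => Y s i) t

/-- The value process `V_t = ξ_t · S_t` of a trading strategy. -/
def valueProcess (S ξ : ℝ≥0 → Fin d → ℝ) (t : ℝ≥0) : ℝ := ξ t ⬝ᵥ S t

/-- A self-financing trading strategy: an admissible integrand `ξ` for `S` with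
`V_t = V_0 + ∫₀ᵗ ξ_s dS_s`. -/
structure IsSelfFinancing (𝕋 : RefiningSequence) (S ξ : ℝ≥0 → Fin d → ℝ) : Prop where
  admissible : IsAdmissibleIntegrand S ξ
  value_eq : ∀ t, valueProcess S ξ t = valueProcess S ξ 0 + follmerIntegral 𝕋 ξ S t

/-- A self-financing strategy without short sales whose value process satisfies `V_0 = 1` and
`V_t > 0` for all `t`. -/
structure IsPositiveLongOnly (𝕋 : RefiningSequence) (S ξ : ℝ≥0 → Fin d → ℝ) : Prop where
  selfFinancing : IsSelfFinancing 𝕋 S ξ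
  noShortSales : ∀ t i, 0 ≤ ξ t i
  value_zero : valueProcess S ξ 0 = 1
  value_pos : ∀ t, 0 < valueProcess S ξ t

/-- A portfolio strategy: a simplex-valued admissible integrand for `ℒ(S)`. -/
structure IsPortfolioStrategy (𝕋 : RefiningSequence) (S π : ℝ≥0 → Fin d → ℝ) : Prop where
  mem_simplex : ∀ t, π t ∈ stdSimplex ℝ (Fin d)
  admissible : IsAdmissibleIntegrand (itoLogVec 𝕋 S) π

/-- The portfolio value process `V^π = ℰ(∫ π dℒ(S))`. -/
def portfolioValue (𝕋 : RefiningSequence) (S π : ℝ≥0 → Fin d → ℝ) : ℝ≥0 → ℝ :=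
  doleansDade 𝕋 (follmerIntegral 𝕋 π (itoLogVec 𝕋 S))

/-- The componentwise quotient `π_t / S_t`. -/
def ratio (π S : ℝ≥0 → Fin d → ℝ) (t : ℝ≥0) : Fin d → ℝ := fun i => π t i / S t i

end PathwiseIto

end

open PathwiseIto

open PathwiseIto

/-! Everything is expressed through interval functions Γ(s, u) summed along the partitions. Write Γ
≈ Γ' if the sums of Γ - Γ' over [0, t] tend to zero for all t ≤ T while the sums of |Γ - Γ'| stay
bounded (`Negl`). This relation is a calculus: it survives multiplication by g(s) with g continuous
(`Negl.mul`), and if the difference is also uniformly small, its squares have vanishing sums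
(`Negl.absNegl_sq`). Taylor remainders are negligible, (δZ)² ≈ δ⟨Z⟩, and a continuous Y with δY ≈ 0
is constant.

In this calculus δℒ(Y) ≈ δY / Y (`IsQV.negl_itoLog`) and δℰ(Z) ≈ ℰ(Z) δZ (`negl_doleansDade`).
Conversely, a positive continuous V with bounded square sums, δV ≈ V δZ, V_0 = 1 and Z_0 = 0 equals
ℰ(Z) (`log_eq_of_negl`). Hence π · δℒ(S) ≈ (π / S) · δS, and the integrals of π along ℒ(S) and of π
/ S along S are the same function Z. Given π, put V = ℰ(Z) and ξ = V π / S; then δV ≈ V δZ ≈ ξ · δS,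
which is the self-financing condition. Given ξ with value V, put π = ξ S / V; then δV ≈ ξ · δS = V
(π / S) · δS ≈ V δZ, so V = ℰ(Z). The two constructions are therefore inverse to each other.

It remains to see that the new integrands are admissible. By the Itô formula (`IsQVVec.exists_ito`)
the integral of ∇ₓ f(X, A) along X is f(X, A) + B up to a constant, with B continuous and of bounded
variation, so V is itself a function of the path and of parameters of bounded variation. With c =
⟨log S⟩ / 2 and suitable b, ξ is the x-gradient of exp(g(log x + c, a) + b) at x = S, and π is the
y-gradient of log(f(exp(y - c), a) + b) at y = ℒ(S). Both are instances of
`IsAdmissibleUpTo.of_reparam`. -/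

namespace PathwiseIto

/-! ### Sums over the intervals of a partition -/

namespace Partition

theorem mem_indices {P : Partition} {t : ℝ≥0} {k : ℕ} :
    k ∈ P.indices t ↔ P.time (k + 1) ≤ t := by
  simp [indices]

theorem time_lt_succ (P : Partition) (k : ℕ) : P.time k < P.time (k + 1) :=
  P.strictMono (Nat.lt_succ_self k)

theorem indices_zero (P : Partition) : P.indices 0 = ∅ := by
  ext k
  simp only [mem_indices, Finset.notMem_empty, iff_false, not_le]
  exact lt_of_le_of_lt (zero_le) (P.time_lt_succ k)

theorem indices_mono (P : Partition) {s t : ℝ≥0} (h : s ≤ t) : P.indices s ⊆ P.indices t :=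
  fun _ hk => mem_indices.2 ((mem_indices.1 hk).trans h)

/-- The number of the last point of the partition that is at most `t`. -/
theorem exists_indices_eq_range (P : Partition) (t : ℝ≥0) :
    ∃ N, P.indices t = Finset.range N ∧ P.time N ≤ t ∧ t < P.time (N + 1) := by
  classical
  have hex : ∃ n, t < P.time (n + 1) := by
    obtain ⟨N, hN⟩ := (P.tendsto.eventually (eventually_gt_atTop t)).exists
    exact ⟨N, hN.trans (P.time_lt_succ N)⟩
  refine ⟨Nat.find hex, ?_, ?_, Nat.find_spec hex⟩
  · ext k
    rw [mem_indices, Finset.mem_range, Nat.lt_find_iff]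
    constructor
    · intro h m hm
      exact not_lt.2 ((P.strictMono.monotone (Nat.succ_le_succ hm)).trans h)
    · intro h
      exact not_lt.1 (h k le_rfl)
  · rcases Nat.eq_zero_or_pos (Nat.find hex) with h0 | h0
    · rw [h0, P.time_zero]; exact zero_le
    · obtain ⟨m, hm⟩ := Nat.exists_eq_succ_of_ne_zero h0.ne'
      rw [hm]
      exact not_lt.1 (Nat.find_min hex (m := m) (by omega))

theorem dist_succ_lt (P : Partition) {ε : ℝ≥0∞} (h : P.mesh < ε) (k : ℕ) :
    edist (P.time (k + 1)) (P.time k) < ε :=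
  (le_iSup (fun k => edist (P.time (k + 1)) (P.time k)) k).trans_lt h

end Partition

variable {𝕋 : RefiningSequence} {Γ Γ' : ℝ≥0 → ℝ≥0 → ℝ} {T : ℝ≥0}

theorem RefiningSequence.points_mono (𝕋 : RefiningSequence) {m n : ℕ} (h : m ≤ n) :
    (𝕋.part m).points ⊆ (𝕋.part n).points :=
  monotone_nat_of_le_succ (f := fun n => (𝕋.part n).points) 𝕋.nested h

theorem RefiningSequence.eventually_dist_lt (𝕋 : RefiningSequence) {ε : ℝ} (hε : 0 < ε) :
    ∀ᶠ n in atTop, ∀ k, dist ((𝕋.part n).time (k + 1)) ((𝕋.part n).time k) < ε := by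
  have h0 : (0 : ℝ≥0∞) < ENNReal.ofReal ε := ENNReal.ofReal_pos.2 hε
  filter_upwards [𝕋.mesh_tendsto.eventually (gt_mem_nhds h0)] with n hn k
  have := (𝕋.part n).dist_succ_lt hn k
  rwa [edist_dist, ENNReal.ofReal_lt_ofReal_iff hε] at this

/-- The increments of a function, as a function of two time points. -/
def incr (Y : ℝ≥0 → ℝ) : ℝ≥0 → ℝ≥0 → ℝ := fun s u => Y u - Y s

/-- `∑_{s ∈ 𝕋ₙ, s' ≤ t} Γ(s, s')`. -/
noncomputable def partSum (𝕋 : RefiningSequence) (Γ : ℝ≥0 → ℝ≥0 → ℝ) (n : ℕ) (t : ℝ≥0) : ℝ :=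
  ∑ k ∈ (𝕋.part n).indices t, Γ ((𝕋.part n).time k) ((𝕋.part n).time (k + 1))

theorem partSum_zero_time (n : ℕ) : partSum 𝕋 Γ n 0 = 0 := by
  simp [partSum, Partition.indices_zero]

theorem partSum_add (n : ℕ) (t : ℝ≥0) :
    partSum 𝕋 (fun s u => Γ s u + Γ' s u) n t = partSum 𝕋 Γ n t + partSum 𝕋 Γ' n t :=
  Finset.sum_add_distrib

theorem partSum_sub (n : ℕ) (t : ℝ≥0) :
    partSum 𝕋 (fun s u => Γ s u - Γ' s u) n t = partSum 𝕋 Γ n t - partSum 𝕋 Γ' n t :=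
  Finset.sum_sub_distrib _ _

theorem partSum_const_mul (c : ℝ) (n : ℕ) (t : ℝ≥0) :
    partSum 𝕋 (fun s u => c * Γ s u) n t = c * partSum 𝕋 Γ n t :=
  (Finset.mul_sum _ _ _).symm

theorem partSum_sum {ι : Type*} (I : Finset ι) (G : ι → ℝ≥0 → ℝ≥0 → ℝ) (n : ℕ) (t : ℝ≥0) :
    partSum 𝕋 (fun s u => ∑ i ∈ I, G i s u) n t = ∑ i ∈ I, partSum 𝕋 (G i) n t :=
  Finset.sum_comm

/-- It suffices to compare the summands on the intervals that end before `T`. -/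
theorem partSum_le {n : ℕ} {t : ℝ≥0} (ht : t ≤ T)
    (h : ∀ s u, s < u → u ≤ T → Γ s u ≤ Γ' s u) : partSum 𝕋 Γ n t ≤ partSum 𝕋 Γ' n t :=
  Finset.sum_le_sum fun k hk =>
    h _ _ ((𝕋.part n).time_lt_succ k) ((Partition.mem_indices.1 hk).trans ht)

theorem partSum_congr {n : ℕ} {t : ℝ≥0} (ht : t ≤ T)
    (h : ∀ s u, s < u → u ≤ T → Γ s u = Γ' s u) : partSum 𝕋 Γ n t = partSum 𝕋 Γ' n t :=
  Finset.sum_congr rfl fun k hk =>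
    h _ _ ((𝕋.part n).time_lt_succ k) ((Partition.mem_indices.1 hk).trans ht)

theorem partSum_mono {n : ℕ} {s t : ℝ≥0} (hst : s ≤ t) (h : ∀ s u, 0 ≤ Γ s u) :
    partSum 𝕋 Γ n s ≤ partSum 𝕋 Γ n t :=
  Finset.sum_le_sum_of_subset_of_nonneg ((𝕋.part n).indices_mono hst) fun _ _ _ => h _ _

theorem partSum_nonneg {n : ℕ} {t : ℝ≥0} (h : ∀ s u, 0 ≤ Γ s u) : 0 ≤ partSum 𝕋 Γ n t :=
  Finset.sum_nonneg fun _ _ => h _ _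

theorem abs_partSum_le (n : ℕ) (t : ℝ≥0) :
    |partSum 𝕋 Γ n t| ≤ partSum 𝕋 (fun s u => |Γ s u|) n t :=
  Finset.abs_sum_le_sum_abs _ _

theorem exists_partSum_incr (Y : ℝ≥0 → ℝ) (n : ℕ) (t : ℝ≥0) :
    ∃ N, partSum 𝕋 (incr Y) n t = Y ((𝕋.part n).time N) - Y 0 ∧ (𝕋.part n).time N ≤ t ∧
      t < (𝕋.part n).time (N + 1) := by
  obtain ⟨N, hN, h1, h2⟩ := (𝕋.part n).exists_indices_eq_range t
  refine ⟨N, ?_, h1, h2⟩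
  rw [partSum, hN]
  simp only [incr]
  rw [Finset.sum_range_sub (fun k => Y ((𝕋.part n).time k)), (𝕋.part n).time_zero]

theorem exists_forall_dist_lt {Y : ℝ≥0 → ℝ} (hY : ContinuousOn Y (Icc 0 T)) {ε : ℝ} (hε : 0 < ε) :
    ∃ δ > 0, ∀ s ≤ T, ∀ u ≤ T, dist s u < δ → |Y s - Y u| < ε := by
  have h := isCompact_Icc.uniformContinuousOn_of_continuous hY
  rw [Metric.uniformContinuousOn_iff] at h
  obtain ⟨δ, hδ, h⟩ := h ε hε
  exact ⟨δ, hδ, fun s hs u hu hd => by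
    simpa [Real.dist_eq] using h s ⟨zero_le, hs⟩ u ⟨zero_le, hu⟩ hd⟩

/-- The increments of a continuous function along the partitions are uniformly small. -/
theorem eventually_abs_incr_lt {Y : ℝ≥0 → ℝ} (hY : ContinuousOn Y (Icc 0 T)) {ε : ℝ}
    (hε : 0 < ε) :
    ∀ᶠ n in atTop, ∀ k ∈ (𝕋.part n).indices T,
      |incr Y ((𝕋.part n).time k) ((𝕋.part n).time (k + 1))| < ε := by
  obtain ⟨δ, hδ, h⟩ := exists_forall_dist_lt hY hε
  filter_upwards [𝕋.eventually_dist_lt hδ] with n hn k hk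
  have hk' := Partition.mem_indices.1 hk
  exact h _ hk' _ (((𝕋.part n).time_lt_succ k).le.trans hk') (hn k)

/-- The sum of the increments of a continuous function up to the last partition point before `t`
is close to the increment over `[0, t]`, uniformly in `t`. -/
theorem eventually_abs_partSum_incr_lt {Y : ℝ≥0 → ℝ} (hY : ContinuousOn Y (Icc 0 T)) {ε : ℝ}
    (hε : 0 < ε) :
    ∀ᶠ n in atTop, ∀ t ≤ T, |partSum 𝕋 (incr Y) n t - (Y t - Y 0)| < ε := by
  obtain ⟨δ, hδ, h⟩ := exists_forall_dist_lt hY hε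
  filter_upwards [𝕋.eventually_dist_lt hδ] with n hn t ht
  obtain ⟨N, hN, h1, h2⟩ := exists_partSum_incr (𝕋 := 𝕋) Y n t
  rw [hN, sub_sub_sub_cancel_right]
  refine h _ (h1.trans ht) _ ht (lt_of_le_of_lt ?_ (hn N))
  rw [dist_comm, NNReal.dist_eq, NNReal.dist_eq]
  have h1' : ((𝕋.part n).time N : ℝ) ≤ t := h1
  have h2' : (t : ℝ) ≤ (𝕋.part n).time (N + 1) := h2.le
  rw [abs_of_nonneg (by linarith), abs_of_nonneg (by linarith)]
  linarith

theorem tendsto_partSum_incr {Y : ℝ≥0 → ℝ} (hY : ContinuousOn Y (Icc 0 T)) {t : ℝ≥0}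
    (ht : t ≤ T) : Tendsto (fun n => partSum 𝕋 (incr Y) n t) atTop (𝓝 (Y t - Y 0)) := by
  rw [Metric.tendsto_nhds]
  intro ε hε
  filter_upwards [eventually_abs_partSum_incr_lt (𝕋 := 𝕋) hY hε] with n hn
  exact hn t ht

/-- Restricting the sum to the intervals after a partition point. -/
theorem partSum_indicator {m n : ℕ} (hmn : m ≤ n) (j : ℕ) (t : ℝ≥0) :
    partSum 𝕋 (fun s u => (if (𝕋.part m).time j ≤ s then 1 else 0) * Γ s u) n t =
      partSum 𝕋 Γ n t - partSum 𝕋 Γ n (min t ((𝕋.part m).time j)) := by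
  -- Nestedness enters here: the threshold is itself a point of the finer partition, so no interval
  -- straddles it.
  obtain ⟨l, hl⟩ := 𝕋.points_mono hmn ⟨j, rfl⟩
  simp only [partSum, ite_mul, one_mul, zero_mul]
  rw [← Finset.sum_filter, eq_sub_iff_add_eq,
    ← Finset.sum_filter_add_sum_filter_not ((𝕋.part n).indices t)
      (fun k => (𝕋.part m).time j ≤ (𝕋.part n).time k)]
  congr 1
  refine Finset.sum_congr ?_ fun _ _ => rfl
  ext k
  rw [Finset.mem_filter, Partition.mem_indices, Partition.mem_indices, le_min_iff, ← hl,
    (𝕋.part n).strictMono.le_iff_le, (𝕋.part n).strictMono.le_iff_le]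
  refine and_congr_right fun _ => ?_
  omega

/-! ### Convergence of sums along the partitions -/

/-- The sums of `|Γ|` over `[0, T]` are bounded. -/
def BddSum (𝕋 : RefiningSequence) (Γ : ℝ≥0 → ℝ≥0 → ℝ) (T : ℝ≥0) : Prop :=
  ∃ C, ∀ n, partSum 𝕋 (fun s u => |Γ s u|) n T ≤ C

/-- The sums of `Γ` have bounded variation and converge on `[0, T]` to a continuous function. -/
structure SumsTo (𝕋 : RefiningSequence) (Γ : ℝ≥0 → ℝ≥0 → ℝ) (M : ℝ≥0 → ℝ) (T : ℝ≥0) : Prop where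
  bdd : BddSum 𝕋 Γ T
  cont : ContinuousOn M (Icc 0 T)
  tendsto : ∀ t ≤ T, Tendsto (fun n => partSum 𝕋 Γ n t) atTop (𝓝 (M t))

/-- The sums of `Γ` are bounded and converge to zero on `[0, T]`. -/
def Negl (𝕋 : RefiningSequence) (Γ : ℝ≥0 → ℝ≥0 → ℝ) (T : ℝ≥0) : Prop :=
  SumsTo 𝕋 Γ (fun _ => 0) T

/-- The sums of `|Γ|` converge to zero on `[0, T]`. -/
def AbsNegl (𝕋 : RefiningSequence) (Γ : ℝ≥0 → ℝ≥0 → ℝ) (T : ℝ≥0) : Prop :=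
  Tendsto (fun n => partSum 𝕋 (fun s u => |Γ s u|) n T) atTop (𝓝 0)

theorem BddSum.mono (h : BddSum 𝕋 Γ T) (h' : ∀ s u, s < u → u ≤ T → |Γ' s u| ≤ |Γ s u|) :
    BddSum 𝕋 Γ' T := by
  obtain ⟨C, hC⟩ := h
  exact ⟨C, fun n => (partSum_le le_rfl h').trans (hC n)⟩

theorem BddSum.add (h : BddSum 𝕋 Γ T) (h' : BddSum 𝕋 Γ' T) :
    BddSum 𝕋 (fun s u => Γ s u + Γ' s u) T := by
  obtain ⟨C, hC⟩ := h
  obtain ⟨C', hC'⟩ := h'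
  refine ⟨C + C', fun n => ?_⟩
  refine (partSum_le (T := T) le_rfl fun s u _ _ => abs_add_le _ _).trans ?_
  rw [partSum_add]
  exact add_le_add (hC n) (hC' n)

theorem BddSum.const_mul (c : ℝ) (h : BddSum 𝕋 Γ T) : BddSum 𝕋 (fun s u => c * Γ s u) T := by
  obtain ⟨C, hC⟩ := h
  refine ⟨|c| * C, fun n => ?_⟩
  simp only [abs_mul]
  rw [partSum_const_mul]
  exact mul_le_mul_of_nonneg_left (hC n) (abs_nonneg _)

theorem exists_abs_le {g : ℝ≥0 → ℝ} (hg : ContinuousOn g (Icc 0 T)) :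
    ∃ C, 0 ≤ C ∧ ∀ s ≤ T, |g s| ≤ C := by
  obtain ⟨C, hC⟩ := isCompact_Icc.exists_bound_of_continuousOn hg
  exact ⟨|C|, abs_nonneg _, fun s hs => (hC s ⟨zero_le, hs⟩).trans (le_abs_self _)⟩

theorem BddSum.mul {g : ℝ≥0 → ℝ} (h : BddSum 𝕋 Γ T) (hg : ContinuousOn g (Icc 0 T)) :
    BddSum 𝕋 (fun s u => g s * Γ s u) T := by
  obtain ⟨C, hC0, hC⟩ := exists_abs_le hg
  refine (h.const_mul C).mono fun s u hsu hu => ?_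
  rw [abs_mul, abs_mul, abs_of_nonneg hC0]
  exact mul_le_mul_of_nonneg_right (hC s (hsu.le.trans hu)) (abs_nonneg _)

theorem BddSum.sum {ι : Type*} (I : Finset ι) {G : ι → ℝ≥0 → ℝ≥0 → ℝ}
    (h : ∀ i ∈ I, BddSum 𝕋 (G i) T) : BddSum 𝕋 (fun s u => ∑ i ∈ I, G i s u) T := by
  classical
  induction I using Finset.induction_on with
  | empty => exact ⟨0, fun n => by simp [partSum]⟩
  | insert a I ha ih =>
    simp only [Finset.sum_insert ha]
    exact (h a (Finset.mem_insert_self _ _)).add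
      (ih fun i hi => h i (Finset.mem_insert_of_mem hi))

theorem SumsTo.congr {M M' : ℝ≥0 → ℝ} (h : SumsTo 𝕋 Γ M T)
    (hΓ : ∀ s u, s < u → u ≤ T → Γ' s u = Γ s u) (hM : ∀ t ≤ T, M' t = M t) :
    SumsTo 𝕋 Γ' M' T where
  bdd := h.bdd.mono fun s u hs hu => by rw [hΓ s u hs hu]
  cont := h.cont.congr fun t ht => hM t ht.2
  tendsto t ht := by
    simp only [partSum_congr ht hΓ, hM t ht]
    exact h.tendsto t ht

theorem SumsTo.add {M M' : ℝ≥0 → ℝ} (h : SumsTo 𝕋 Γ M T) (h' : SumsTo 𝕋 Γ' M' T) :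
    SumsTo 𝕋 (fun s u => Γ s u + Γ' s u) (fun t => M t + M' t) T where
  bdd := h.bdd.add h'.bdd
  cont := h.cont.add h'.cont
  tendsto t ht := by
    simp only [partSum_add]
    exact (h.tendsto t ht).add (h'.tendsto t ht)

theorem SumsTo.const_mul {M : ℝ≥0 → ℝ} (c : ℝ) (h : SumsTo 𝕋 Γ M T) :
    SumsTo 𝕋 (fun s u => c * Γ s u) (fun t => c * M t) T where
  bdd := h.bdd.const_mul c
  cont := continuousOn_const.mul h.cont
  tendsto t ht := by
    simp only [partSum_const_mul]
    exact (h.tendsto t ht).const_mul c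

theorem SumsTo.sub {M M' : ℝ≥0 → ℝ} (h : SumsTo 𝕋 Γ M T) (h' : SumsTo 𝕋 Γ' M' T) :
    SumsTo 𝕋 (fun s u => Γ s u - Γ' s u) (fun t => M t - M' t) T :=
  (h.add (h'.const_mul (-1))).congr (fun _ _ _ _ => by ring) (fun _ _ => by ring)

theorem SumsTo.sum {ι : Type*} (I : Finset ι) {G : ι → ℝ≥0 → ℝ≥0 → ℝ} {M : ι → ℝ≥0 → ℝ}
    (h : ∀ i ∈ I, SumsTo 𝕋 (G i) (M i) T) :
    SumsTo 𝕋 (fun s u => ∑ i ∈ I, G i s u) (fun t => ∑ i ∈ I, M i t) T where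
  bdd := BddSum.sum I fun i hi => (h i hi).bdd
  cont := continuousOn_finsetSum _ fun i hi => (h i hi).cont
  tendsto t ht := by
    simp only [partSum_sum]
    exact tendsto_finsetSum _ fun i hi => (h i hi).tendsto t ht

theorem SumsTo.apply_zero {M : ℝ≥0 → ℝ} (h : SumsTo 𝕋 Γ M T) : M 0 = 0 := by
  have := h.tendsto 0 (zero_le)
  simp only [partSum_zero_time] at this
  exact tendsto_nhds_unique this tendsto_const_nhds

theorem SumsTo.mono {M : ℝ≥0 → ℝ} (h : SumsTo 𝕋 Γ M T) {T' : ℝ≥0} (hT : T' ≤ T) :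
    SumsTo 𝕋 Γ M T' where
  bdd := by
    obtain ⟨C, hC⟩ := h.bdd
    exact ⟨C, fun n => (partSum_mono hT fun _ _ => abs_nonneg _).trans (hC n)⟩
  cont := h.cont.mono (Icc_subset_Icc_right hT)
  tendsto t ht := h.tendsto t (ht.trans hT)

theorem Negl.add (h : Negl 𝕋 Γ T) (h' : Negl 𝕋 Γ' T) : Negl 𝕋 (fun s u => Γ s u + Γ' s u) T :=
  (SumsTo.add h h').congr (fun _ _ _ _ => rfl) (fun _ _ => by simp)

theorem Negl.sub (h : Negl 𝕋 Γ T) (h' : Negl 𝕋 Γ' T) : Negl 𝕋 (fun s u => Γ s u - Γ' s u) T :=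
  (SumsTo.sub h h').congr (fun _ _ _ _ => rfl) (fun _ _ => by simp)

theorem Negl.const_mul (c : ℝ) (h : Negl 𝕋 Γ T) : Negl 𝕋 (fun s u => c * Γ s u) T :=
  (SumsTo.const_mul c h).congr (fun _ _ _ _ => rfl) (fun _ _ => by simp)

theorem Negl.sum {ι : Type*} (I : Finset ι) {G : ι → ℝ≥0 → ℝ≥0 → ℝ}
    (h : ∀ i ∈ I, Negl 𝕋 (G i) T) : Negl 𝕋 (fun s u => ∑ i ∈ I, G i s u) T :=
  (SumsTo.sum I h).congr (fun _ _ _ _ => rfl) (fun _ _ => by simp)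

theorem Negl.congr (h : Negl 𝕋 Γ T) (hΓ : ∀ s u, s < u → u ≤ T → Γ' s u = Γ s u) :
    Negl 𝕋 Γ' T :=
  SumsTo.congr h hΓ fun _ _ => rfl

theorem SumsTo.add_negl {M : ℝ≥0 → ℝ} (h : SumsTo 𝕋 Γ M T) (h' : Negl 𝕋 Γ' T) :
    SumsTo 𝕋 (fun s u => Γ s u + Γ' s u) M T :=
  (h.add h').congr (fun _ _ _ _ => rfl) (fun _ _ => by simp)

theorem AbsNegl.bdd (h : AbsNegl 𝕋 Γ T) : BddSum 𝕋 Γ T := by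
  obtain ⟨C, hC⟩ := h.bddAbove_range
  exact ⟨C, fun n => hC ⟨n, rfl⟩⟩

theorem AbsNegl.negl (h : AbsNegl 𝕋 Γ T) : Negl 𝕋 Γ T where
  bdd := h.bdd
  cont := continuousOn_const
  tendsto t ht := squeeze_zero_norm (fun n => (abs_partSum_le n t).trans
    (partSum_mono ht fun _ _ => abs_nonneg _)) h

/-- Sums of a nonnegative expression that converge are bounded. -/
theorem BddSum.of_tendsto (h0 : ∀ s u, 0 ≤ Γ s u) {x : ℝ}
    (h : Tendsto (fun n => partSum 𝕋 Γ n T) atTop (𝓝 x)) : BddSum 𝕋 Γ T := by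
  obtain ⟨C, hC⟩ := h.bddAbove_range
  refine ⟨C, fun n => ?_⟩
  simp only [abs_of_nonneg (h0 _ _)]
  exact hC ⟨n, rfl⟩

theorem AbsNegl.mono (h : AbsNegl 𝕋 Γ T) (h' : ∀ s u, s < u → u ≤ T → |Γ' s u| ≤ |Γ s u|) :
    AbsNegl 𝕋 Γ' T :=
  squeeze_zero (fun _ => partSum_nonneg fun _ _ => abs_nonneg _)
    (fun _ => partSum_le le_rfl h') h

theorem AbsNegl.congr (h : AbsNegl 𝕋 Γ T) (h' : ∀ s u, s < u → u ≤ T → Γ' s u = Γ s u) :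
    AbsNegl 𝕋 Γ' T :=
  h.mono fun s u hs hu => by rw [h' s u hs hu]

theorem AbsNegl.add (h : AbsNegl 𝕋 Γ T) (h' : AbsNegl 𝕋 Γ' T) :
    AbsNegl 𝕋 (fun s u => Γ s u + Γ' s u) T := by
  have := Tendsto.add h h'
  rw [add_zero] at this
  refine squeeze_zero (fun _ => partSum_nonneg fun _ _ => abs_nonneg _) (fun n => ?_) this
  rw [← partSum_add]
  exact partSum_le (T := T) le_rfl fun s u _ _ => abs_add_le _ _

theorem AbsNegl.const_mul (c : ℝ) (h : AbsNegl 𝕋 Γ T) : AbsNegl 𝕋 (fun s u => c * Γ s u) T := by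
  have := Tendsto.const_mul |c| h
  rw [mul_zero] at this
  refine this.congr fun n => ?_
  simp only [abs_mul, partSum_const_mul]

/-- An expression that is uniformly small relative to one with bounded sums is negligible. -/
theorem AbsNegl.of_small (h : BddSum 𝕋 Γ T)
    (h' : ∀ ε > 0, ∀ᶠ n in atTop, ∀ k ∈ (𝕋.part n).indices T,
      |Γ' ((𝕋.part n).time k) ((𝕋.part n).time (k + 1))| ≤
        ε * |Γ ((𝕋.part n).time k) ((𝕋.part n).time (k + 1))|) : AbsNegl 𝕋 Γ' T := by
  obtain ⟨C, hC⟩ := h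
  have hC0 : 0 ≤ C := (partSum_nonneg fun _ _ => abs_nonneg _).trans (hC 0)
  rw [AbsNegl, Metric.tendsto_nhds]
  intro ε hε
  -- Dividing by `C + 1` instead of `C` covers the case `C = 0`.
  filter_upwards [h' (ε / (C + 1)) (by positivity)] with n hn
  rw [Real.dist_eq, sub_zero, abs_of_nonneg (partSum_nonneg fun _ _ => abs_nonneg _)]
  calc partSum 𝕋 (fun s u => |Γ' s u|) n T
      ≤ partSum 𝕋 (fun s u => ε / (C + 1) * |Γ s u|) n T := Finset.sum_le_sum hn
    _ = ε / (C + 1) * partSum 𝕋 (fun s u => |Γ s u|) n T := partSum_const_mul _ _ _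
    _ ≤ ε / (C + 1) * C := mul_le_mul_of_nonneg_left (hC n) (by positivity)
    _ < ε := by
        rw [div_mul_eq_mul_div, div_lt_iff₀ (by linarith)]
        nlinarith

/-- The square of an expression with bounded sums and uniformly small values is negligible. -/
theorem AbsNegl.sq (h : BddSum 𝕋 Γ T)
    (h' : ∀ ε > 0, ∀ᶠ n in atTop, ∀ k ∈ (𝕋.part n).indices T,
      |Γ ((𝕋.part n).time k) ((𝕋.part n).time (k + 1))| < ε) :
    AbsNegl 𝕋 (fun s u => Γ s u ^ 2) T := by
  refine AbsNegl.of_small h fun ε hε => ?_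
  filter_upwards [h' ε hε] with n hn k hk
  rw [pow_two, abs_mul]
  exact mul_le_mul_of_nonneg_right (hn k hk).le (abs_nonneg _)

/-- Cauchy-Schwarz: the product of a square-negligible and a square-bounded expression. -/
theorem AbsNegl.mul_of_sq (h : AbsNegl 𝕋 (fun s u => Γ s u ^ 2) T)
    (h' : BddSum 𝕋 (fun s u => Γ' s u ^ 2) T) : AbsNegl 𝕋 (fun s u => Γ s u * Γ' s u) T := by
  obtain ⟨C, hC⟩ := h'
  have h2 : Tendsto (fun n => √(partSum 𝕋 (fun s u => |Γ s u ^ 2|) n T) * √C) atTop (𝓝 0) := by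
    have := (Real.continuous_sqrt.tendsto 0).comp h
    rw [Real.sqrt_zero] at this
    simpa using this.mul_const (√C)
  refine squeeze_zero (fun _ => partSum_nonneg fun _ _ => abs_nonneg _) (fun n => ?_) h2
  rw [← Real.sqrt_mul (partSum_nonneg fun _ _ => abs_nonneg _)]
  refine Real.le_sqrt_of_sq_le ?_
  simp only [abs_mul]
  refine (Finset.sum_mul_sq_le_sq_mul_sq _ _ _).trans ?_
  simp only [sq_abs]
  have e : ∀ G : ℝ≥0 → ℝ≥0 → ℝ, ∑ k ∈ (𝕋.part n).indices T,
      G ((𝕋.part n).time k) ((𝕋.part n).time (k + 1)) ^ 2 =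
        partSum 𝕋 (fun s u => |G s u ^ 2|) n T := fun G => by
    simp only [partSum, abs_pow, sq_abs]
  rw [e, e]
  exact mul_le_mul_of_nonneg_left (hC n) (partSum_nonneg fun _ _ => abs_nonneg _)

theorem AbsNegl.sq_sub_sq (h : AbsNegl 𝕋 (fun s u => (Γ s u - Γ' s u) ^ 2) T)
    (h' : BddSum 𝕋 (fun s u => Γ' s u ^ 2) T) :
    AbsNegl 𝕋 (fun s u => Γ s u ^ 2 - Γ' s u ^ 2) T :=
  (h.add ((AbsNegl.mul_of_sq (Γ := fun s u => Γ s u - Γ' s u) h h').const_mul 2)).congr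
    fun _ _ _ _ => by ring

end PathwiseIto

/-! ### Functions of bounded variation -/

theorem BoundedVariationOn.of_edist_le_sum {α ι F : Type*} [LinearOrder α] [PseudoEMetricSpace F]
    {E : ι → Type*} [∀ i, PseudoEMetricSpace (E i)] (I : Finset ι) {h : α → F}
    {f : ∀ i, α → E i} {s : Set α} (hf : ∀ i ∈ I, BoundedVariationOn (f i) s)
    (hle : ∀ x ∈ s, ∀ y ∈ s, edist (h x) (h y) ≤ ∑ i ∈ I, edist (f i x) (f i y)) :
    BoundedVariationOn h s := by
  refine ne_top_of_le_ne_top (ENNReal.sum_ne_top.2 hf) (iSup_le ?_)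
  rintro ⟨n, u, hu, us⟩
  calc ∑ k ∈ Finset.range n, edist (h (u (k + 1))) (h (u k))
      ≤ ∑ k ∈ Finset.range n, ∑ i ∈ I, edist (f i (u (k + 1))) (f i (u k)) :=
        Finset.sum_le_sum fun k _ => hle _ (us _) _ (us _)
    _ = ∑ i ∈ I, ∑ k ∈ Finset.range n, edist (f i (u (k + 1))) (f i (u k)) := Finset.sum_comm
    _ ≤ ∑ i ∈ I, eVariationOn (f i) s := Finset.sum_le_sum fun i _ => eVariationOn.sum_le hu us

theorem BoundedVariationOn.of_edist_le_add {α E F G : Type*} [LinearOrder α]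
    [PseudoEMetricSpace E] [PseudoEMetricSpace F] [PseudoEMetricSpace G] {h : α → G} {f : α → E}
    {g : α → F} {s : Set α} (hf : BoundedVariationOn f s) (hg : BoundedVariationOn g s)
    (hle : ∀ x ∈ s, ∀ y ∈ s, edist (h x) (h y) ≤ edist (f x) (f y) + edist (g x) (g y)) :
    BoundedVariationOn h s := by
  refine ne_top_of_le_ne_top (ENNReal.add_ne_top.2 ⟨hf, hg⟩) (iSup_le ?_)
  rintro ⟨n, u, hu, us⟩
  refine (Finset.sum_le_sum fun k _ => hle _ (us _) _ (us _)).trans ?_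
  rw [Finset.sum_add_distrib]
  exact add_le_add (eVariationOn.sum_le hu us) (eVariationOn.sum_le hu us)

theorem BoundedVariationOn.add {α E : Type*} [LinearOrder α] [SeminormedAddCommGroup E]
    {f g : α → E} {s : Set α} (hf : BoundedVariationOn f s) (hg : BoundedVariationOn g s) :
    BoundedVariationOn (fun x => f x + g x) s :=
  hf.of_edist_le_add hg fun _ _ _ _ => edist_add_add_le _ _ _ _

/-- An admissible integrand has a single parameter `A`; this lemma bundles several parameters of
bounded variation into one. -/
theorem BoundedVariationOn.prodMk {α E F : Type*} [LinearOrder α] [PseudoEMetricSpace E]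
    [PseudoEMetricSpace F] {f : α → E} {g : α → F} {s : Set α} (hf : BoundedVariationOn f s)
    (hg : BoundedVariationOn g s) : BoundedVariationOn (fun x => (f x, g x)) s :=
  hf.of_edist_le_add hg fun _ _ _ _ => max_le le_self_add le_add_self

theorem BoundedVariationOn.pi {α ι : Type*} [LinearOrder α] [Fintype ι] {E : ι → Type*}
    [∀ i, PseudoEMetricSpace (E i)] {f : α → ∀ i, E i} {s : Set α}
    (hf : ∀ i, BoundedVariationOn (fun x => f x i) s) : BoundedVariationOn f s :=
  BoundedVariationOn.of_edist_le_sum Finset.univ (fun i _ => hf i) fun x _ y _ =>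
    edist_pi_le_iff.2 fun i => Finset.single_le_sum (f := fun i => edist (f x i) (f y i))
      (fun _ _ => zero_le) (Finset.mem_univ i)

theorem BoundedVariationOn.const_mul {α : Type*} [LinearOrder α] {f : α → ℝ} {s : Set α}
    (c : ℝ) (hf : BoundedVariationOn f s) : BoundedVariationOn (fun x => c * f x) s :=
  (ContinuousLinearMap.lipschitz (c • ContinuousLinearMap.id ℝ ℝ)).comp_boundedVariationOn hf

/-! ### Limits of sums along the partitions and weighting by continuous functions -/

namespace PathwiseIto

variable {𝕋 : RefiningSequence} {Γ Γ' : ℝ≥0 → ℝ≥0 → ℝ} {T : ℝ≥0}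

theorem sum_indices_sub_sum_indices (P : Partition) {s t : ℝ≥0} (h : s ≤ t) (G : ℕ → ℝ) :
    ∑ k ∈ P.indices t, G k - ∑ k ∈ P.indices s, G k = ∑ k ∈ P.indices t \ P.indices s, G k := by
  rw [← Finset.sum_sdiff (P.indices_mono h), add_sub_cancel_right]

theorem abs_partSum_sub_le {n : ℕ} {s t : ℝ≥0} (h : s ≤ t) :
    |partSum 𝕋 Γ n t - partSum 𝕋 Γ n s| ≤
      partSum 𝕋 (fun s u => |Γ s u|) n t - partSum 𝕋 (fun s u => |Γ s u|) n s := by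
  simp only [partSum]
  rw [sum_indices_sub_sum_indices _ h, sum_indices_sub_sum_indices _ h]
  exact Finset.abs_sum_le_sum_abs _ _

/-- The limit of the sums has bounded variation. -/
theorem SumsTo.boundedVariationOn {M : ℝ≥0 → ℝ} (h : SumsTo 𝕋 Γ M T) :
    BoundedVariationOn M (Icc 0 T) := by
  obtain ⟨C, hC⟩ := h.bdd
  refine ne_top_of_le_ne_top (ENNReal.ofReal_ne_top (r := C)) (iSup_le ?_)
  rintro ⟨N, u, hu, us⟩
  -- For fixed `n` the increments of the sums of Γ are dominated by those of the sums of |Γ|, which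
  -- telescope to at most `C`; the bound passes to the limit in `n`.
  have key : ∑ k ∈ Finset.range N, |M (u (k + 1)) - M (u k)| ≤ C := by
    have hlim : Tendsto (fun n => ∑ k ∈ Finset.range N,
        |partSum 𝕋 Γ n (u (k + 1)) - partSum 𝕋 Γ n (u k)|) atTop
        (𝓝 (∑ k ∈ Finset.range N, |M (u (k + 1)) - M (u k)|)) :=
      tendsto_finsetSum _ fun k _ =>
        ((h.tendsto _ (us _).2).sub (h.tendsto _ (us _).2)).abs
    refine le_of_tendsto hlim (Eventually.of_forall fun n => ?_)
    calc ∑ k ∈ Finset.range N, |partSum 𝕋 Γ n (u (k + 1)) - partSum 𝕋 Γ n (u k)|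
        ≤ ∑ k ∈ Finset.range N, (partSum 𝕋 (fun s u => |Γ s u|) n (u (k + 1)) -
            partSum 𝕋 (fun s u => |Γ s u|) n (u k)) :=
          Finset.sum_le_sum fun k _ => abs_partSum_sub_le (hu (Nat.le_succ k))
      _ = partSum 𝕋 (fun s u => |Γ s u|) n (u N) - partSum 𝕋 (fun s u => |Γ s u|) n (u 0) :=
          Finset.sum_range_sub (fun k => partSum 𝕋 (fun s u => |Γ s u|) n (u k)) N
      _ ≤ partSum 𝕋 (fun s u => |Γ s u|) n T := by
          have h1 := partSum_mono (𝕋 := 𝕋) (Γ := fun s u => |Γ s u|) (n := n) (us N).2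
            fun _ _ => abs_nonneg _
          have h2 := partSum_nonneg (𝕋 := 𝕋) (Γ := fun s u => |Γ s u|) (n := n) (t := u 0)
            fun _ _ => abs_nonneg _
          linarith
      _ ≤ C := hC n
  refine le_trans (le_of_eq ?_) (ENNReal.ofReal_le_ofReal key)
  rw [ENNReal.ofReal_sum_of_nonneg fun _ _ => abs_nonneg _]
  simp only [edist_dist, Real.dist_eq]

theorem BddSum.incr_of_boundedVariationOn {A : ℝ≥0 → ℝ} (hA : BoundedVariationOn A (Icc 0 T)) :
    BddSum 𝕋 (incr A) T := by
  refine ⟨(eVariationOn A (Icc 0 T)).toReal, fun n => ?_⟩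
  obtain ⟨N, hN, h1, -⟩ := (𝕋.part n).exists_indices_eq_range T
  -- Only the points with index at most `N` lie in [0, T], so the partition is used as a monotone
  -- sequence on `Iic N`.
  have := eVariationOn.sum_le_of_monotoneOn_Iic (f := A) (s := Icc 0 T) (n := N)
    (u := (𝕋.part n).time) ((𝕋.part n).strictMono.monotone.monotoneOn _)
    fun i hi => ⟨zero_le, ((𝕋.part n).strictMono.monotone hi).trans h1⟩
  rw [← ENNReal.ofReal_le_iff_le_toReal hA]
  refine le_trans (le_of_eq ?_) this
  rw [partSum, hN, ENNReal.ofReal_sum_of_nonneg fun _ _ => abs_nonneg _]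
  simp only [edist_dist, Real.dist_eq, incr]

theorem sumsTo_incr {A : ℝ≥0 → ℝ} (hA : BoundedVariationOn A (Icc 0 T))
    (hc : ContinuousOn A (Icc 0 T)) : SumsTo 𝕋 (incr A) (fun t => A t - A 0) T where
  bdd := BddSum.incr_of_boundedVariationOn hA
  cont := hc.sub continuousOn_const
  tendsto _ ht := tendsto_partSum_incr hc ht

/-- This turns convergence of sums into an equivalence of increments, for instance (δX)² ≈ δ⟨X⟩.
Bounded variation of the limit keeps the absolute sums of the difference bounded. -/
theorem SumsTo.negl_sub_incr {M : ℝ≥0 → ℝ} (h : SumsTo 𝕋 Γ M T) :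
    Negl 𝕋 (fun s u => Γ s u - incr M s u) T :=
  (h.sub (sumsTo_incr h.boundedVariationOn h.cont)).congr (fun _ _ _ _ => rfl)
    fun t _ => by simp [h.apply_zero]

theorem AbsNegl.sq_incr {A : ℝ≥0 → ℝ} (hA : BoundedVariationOn A (Icc 0 T))
    (hc : ContinuousOn A (Icc 0 T)) : AbsNegl 𝕋 (fun s u => incr A s u ^ 2) T :=
  AbsNegl.sq (BddSum.incr_of_boundedVariationOn hA) fun _ hε => eventually_abs_incr_lt hc hε

/-- A continuous function with negligible increments is constant. -/
theorem Negl.eq_of_incr {Y : ℝ≥0 → ℝ} (h : Negl 𝕋 (incr Y) T) (hY : ContinuousOn Y (Icc 0 T))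
    {t : ℝ≥0} (ht : t ≤ T) : Y t = Y 0 :=
  sub_eq_zero.1 (tendsto_nhds_unique (tendsto_partSum_incr hY ht) (h.tendsto t ht))

/-- Approximation of `g` by the step function with jumps at the points of the `m`-th partition. -/
noncomputable def stepApprox (𝕋 : RefiningSequence) (g : ℝ≥0 → ℝ) (T : ℝ≥0) (m : ℕ) (s : ℝ≥0) :
    ℝ :=
  g 0 + ∑ j ∈ (𝕋.part m).indices T,
    incr g ((𝕋.part m).time j) ((𝕋.part m).time (j + 1)) *
      (if (𝕋.part m).time (j + 1) ≤ s then 1 else 0)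

theorem stepApprox_eq (g : ℝ≥0 → ℝ) (m : ℕ) {s : ℝ≥0} (hs : s ≤ T) :
    stepApprox 𝕋 g T m s = g 0 + partSum 𝕋 (incr g) m s := by
  simp only [stepApprox, mul_ite, mul_one, mul_zero]
  rw [← Finset.sum_filter, partSum]
  congr 2
  ext k
  simp only [Finset.mem_filter, Partition.mem_indices, and_iff_right_iff_imp]
  exact fun h => h.trans hs

/-- For a step function the weighted sum is a finite combination, independent of `n`, of unweighted
sums of Γ, so its limit as `n → ∞` is known. The condition `m ≤ n` puts every jump at a point of the
`n`-th partition. -/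
theorem partSum_stepApprox_mul (g : ℝ≥0 → ℝ) {m n : ℕ} (hmn : m ≤ n) (t : ℝ≥0) :
    partSum 𝕋 (fun s u => stepApprox 𝕋 g T m s * Γ s u) n t =
      g 0 * partSum 𝕋 Γ n t + ∑ j ∈ (𝕋.part m).indices T,
        incr g ((𝕋.part m).time j) ((𝕋.part m).time (j + 1)) *
          (partSum 𝕋 Γ n t - partSum 𝕋 Γ n (min t ((𝕋.part m).time (j + 1)))) := by
  simp only [stepApprox, add_mul, Finset.sum_mul, mul_assoc]
  rw [partSum_add, partSum_const_mul, partSum_sum]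
  simp only [partSum_const_mul, partSum_indicator hmn]

/-- If the sums of `Γ` converge, so do those of `g Γ` for continuous `g`. -/
theorem SumsTo.exists_mul {M g : ℝ≥0 → ℝ} (h : SumsTo 𝕋 Γ M T) (hg : ContinuousOn g (Icc 0 T)) :
    ∃ I, SumsTo 𝕋 (fun s u => g s * Γ s u) I T ∧
      ((∀ t ≤ T, M t = 0) → ∀ t ≤ T, I t = 0) := by
  obtain ⟨C, hC⟩ := h.bdd
  have hC0 : 0 ≤ C := (partSum_nonneg fun _ _ => abs_nonneg _).trans (hC 0)
  set J : ℕ → ℝ≥0 → ℝ := fun m t => g 0 * M t + ∑ j ∈ (𝕋.part m).indices T,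
        incr g ((𝕋.part m).time j) ((𝕋.part m).time (j + 1)) *
          (M t - M (min t ((𝕋.part m).time (j + 1)))) with hJ
  have hJt : ∀ m, ∀ t ≤ T, Tendsto
      (fun n => partSum 𝕋 (fun s u => stepApprox 𝕋 g T m s * Γ s u) n t) atTop (𝓝 (J m t)) := by
    intro m t ht
    refine Tendsto.congr' ((eventually_ge_atTop m).mono fun n hn =>
      (partSum_stepApprox_mul g hn t).symm) ?_
    exact ((h.tendsto t ht).const_mul _).add (tendsto_finsetSum _ fun j _ =>
      ((h.tendsto t ht).sub (h.tendsto _ ((min_le_left _ _).trans ht))).const_mul _)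
  have hJc : ∀ m, ContinuousOn (J m) (Icc 0 T) := by
    intro m
    refine (continuousOn_const.mul h.cont).add (continuousOn_finsetSum _ fun j _ =>
      continuousOn_const.mul (h.cont.sub ?_))
    exact h.cont.comp (by fun_prop) fun t ht => ⟨zero_le, (min_le_left _ _).trans ht.2⟩
  -- The replacement error is at most sup |g - step| times the bound on the sums of |Γ|, hence
  -- uniform in both `n` and `t`. This gives the Cauchy property and lets the continuity of each `J
  -- m` pass to the limit.
  have happ : ∀ ε > 0, ∀ᶠ m in atTop, ∀ n, ∀ t ≤ T,
      |partSum 𝕋 (fun s u => g s * Γ s u) n t -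
        partSum 𝕋 (fun s u => stepApprox 𝕋 g T m s * Γ s u) n t| ≤ ε := by
    intro ε hε
    filter_upwards [eventually_abs_partSum_incr_lt (𝕋 := 𝕋) hg
      (show 0 < ε / (C + 1) by positivity)] with m hm n t ht
    rw [← partSum_sub]
    refine (abs_partSum_le _ _).trans ?_
    calc partSum 𝕋 (fun s u => |g s * Γ s u - stepApprox 𝕋 g T m s * Γ s u|) n t
        ≤ partSum 𝕋 (fun s u => ε / (C + 1) * |Γ s u|) n t := by
          refine partSum_le ht fun s u hs hu => ?_
          have hsT := hs.le.trans hu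
          rw [← sub_mul, abs_mul, stepApprox_eq g m hsT]
          refine mul_le_mul_of_nonneg_right ?_ (abs_nonneg _)
          have := (hm s hsT).le
          rw [abs_sub_comm] at this
          rwa [sub_sub] at this
      _ = ε / (C + 1) * partSum 𝕋 (fun s u => |Γ s u|) n t := partSum_const_mul _ _ _
      _ ≤ ε / (C + 1) * C := mul_le_mul_of_nonneg_left
          ((partSum_mono ht fun _ _ => abs_nonneg _).trans (hC n)) (by positivity)
      _ ≤ ε := by
          rw [div_mul_eq_mul_div, div_le_iff₀ (by linarith)]
          nlinarith
  have hcauchy : ∀ t ≤ T, CauchySeq (fun n => partSum 𝕋 (fun s u => g s * Γ s u) n t) := by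
    intro t ht
    rw [Metric.cauchySeq_iff]
    intro ε hε
    obtain ⟨m, hm⟩ := (happ (ε / 4) (by positivity)).exists
    obtain ⟨N, hN⟩ := Metric.cauchySeq_iff.1 (hJt m t ht).cauchySeq (ε / 4) (by positivity)
    refine ⟨N, fun a ha b hb => ?_⟩
    have h1 := hm a t ht
    have h2 := hm b t ht
    have h3 := hN a ha b hb
    rw [Real.dist_eq] at h3 ⊢
    rw [abs_le] at h1 h2
    rw [abs_lt] at h3 ⊢
    constructor <;> linarith [h1.1, h1.2, h2.1, h2.2, h3.1, h3.2]
  choose! I hI using fun t ht => cauchySeq_tendsto_of_complete (hcauchy t ht)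
  have hIJ : ∀ ε > 0, ∀ᶠ m in atTop, ∀ t ≤ T, |I t - J m t| ≤ ε := by
    intro ε hε
    filter_upwards [happ ε hε] with m hm t ht
    exact le_of_tendsto ((hI t ht).sub (hJt m t ht)).abs
      (Eventually.of_forall fun n => hm n t ht)
  refine ⟨I, ⟨h.bdd.mul hg, ?_, hI⟩, ?_⟩
  · refine TendstoUniformlyOn.continuousOn (F := J) (p := atTop) ?_
      (Eventually.of_forall hJc).frequently
    rw [Metric.tendstoUniformlyOn_iff]
    intro ε hε
    filter_upwards [hIJ (ε / 2) (by positivity)] with m hm t ht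
    rw [Real.dist_eq]
    exact (hm t ht.2).trans_lt (by linarith)
  · intro hM t ht
    refine abs_eq_zero.1 (le_antisymm (le_of_forall_pos_le_add fun ε hε => ?_) (abs_nonneg _))
    obtain ⟨m, hm⟩ := (hIJ ε hε).exists
    have h0 : J m t = 0 := by
      simp only [hJ, hM t ht, hM _ ((min_le_left _ _).trans ht)]
      simp
    have := hm t ht
    rwa [h0, sub_zero, ← zero_add ε] at this

/-- The central rule of the calculus: cancellation between the summands survives a continuous
weight, although the sums of |Γ| need not vanish. -/
theorem Negl.mul {g : ℝ≥0 → ℝ} (h : Negl 𝕋 Γ T) (hg : ContinuousOn g (Icc 0 T)) :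
    Negl 𝕋 (fun s u => g s * Γ s u) T := by
  obtain ⟨I, hI, h0⟩ := SumsTo.exists_mul h hg
  exact hI.congr (fun _ _ _ _ => rfl) fun t ht => (h0 (fun _ _ => rfl) t ht).symm

end PathwiseIto

namespace PathwiseIto

variable {d : ℕ} {𝕋 : RefiningSequence} {Γ Γ' : ℝ≥0 → ℝ≥0 → ℝ} {T : ℝ≥0}

/-! ### Uniformly small expressions -/

/-- The values of `Γ` on the intervals of the partitions tend to zero uniformly. -/
def UnifSmall (𝕋 : RefiningSequence) (Γ : ℝ≥0 → ℝ≥0 → ℝ) (T : ℝ≥0) : Prop :=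
  ∀ ε > 0, ∀ᶠ n in atTop, ∀ k ∈ (𝕋.part n).indices T,
    |Γ ((𝕋.part n).time k) ((𝕋.part n).time (k + 1))| < ε

theorem UnifSmall.incr {Y : ℝ≥0 → ℝ} (hY : ContinuousOn Y (Icc 0 T)) : UnifSmall 𝕋 (incr Y) T :=
  fun _ hε => eventually_abs_incr_lt hY hε

theorem UnifSmall.add (h : UnifSmall 𝕋 Γ T) (h' : UnifSmall 𝕋 Γ' T) :
    UnifSmall 𝕋 (fun s u => Γ s u + Γ' s u) T := by
  intro ε hε
  filter_upwards [h (ε / 2) (by positivity), h' (ε / 2) (by positivity)] with n h1 h2 k hk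
  refine (abs_add_le _ _).trans_lt ?_
  linarith [h1 k hk, h2 k hk]

theorem UnifSmall.mul {g : ℝ≥0 → ℝ} (h : UnifSmall 𝕋 Γ T) (hg : ContinuousOn g (Icc 0 T)) :
    UnifSmall 𝕋 (fun s u => g s * Γ s u) T := by
  obtain ⟨C, hC0, hC⟩ := exists_abs_le hg
  intro ε hε
  filter_upwards [h (ε / (C + 1)) (by positivity)] with n h1 k hk
  have hk' := Partition.mem_indices.1 hk
  rw [abs_mul]
  calc |g ((𝕋.part n).time k)| * |Γ ((𝕋.part n).time k) ((𝕋.part n).time (k + 1))|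
      ≤ C * (ε / (C + 1)) := mul_le_mul
        (hC _ (((𝕋.part n).time_lt_succ k).le.trans hk')) (h1 k hk).le (abs_nonneg _) hC0
    _ < ε := by
      rw [← mul_div_assoc, div_lt_iff₀ (by linarith)]
      nlinarith

theorem UnifSmall.sub (h : UnifSmall 𝕋 Γ T) (h' : UnifSmall 𝕋 Γ' T) :
    UnifSmall 𝕋 (fun s u => Γ s u - Γ' s u) T := by
  have := h.add (h'.mul (g := fun _ => -1) continuousOn_const)
  simpa [← sub_eq_add_neg] using this

theorem UnifSmall.sum {ι : Type*} (I : Finset ι) {G : ι → ℝ≥0 → ℝ≥0 → ℝ}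
    (h : ∀ i ∈ I, UnifSmall 𝕋 (G i) T) : UnifSmall 𝕋 (fun s u => ∑ i ∈ I, G i s u) T := by
  classical
  induction I using Finset.induction_on with
  | empty => exact fun ε hε => Eventually.of_forall fun n k _ => by simpa using hε
  | insert a I ha ih =>
    simp only [Finset.sum_insert ha]
    exact (h a (Finset.mem_insert_self _ _)).add
      (ih fun i hi => h i (Finset.mem_insert_of_mem hi))

/-- One factor of the square is uniformly small and the other has bounded absolute sums; only this
part of negligibility is needed. -/
theorem Negl.absNegl_sq (h : Negl 𝕋 Γ T) (h' : UnifSmall 𝕋 Γ T) :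
    AbsNegl 𝕋 (fun s u => Γ s u ^ 2) T :=
  AbsNegl.sq h.bdd h'

/-! ### Quadratic variation -/

theorem continuous_of_continuousOn_Icc {E : Type*} [TopologicalSpace E] {f : ℝ≥0 → E}
    (h : ∀ T, 0 < T → ContinuousOn f (Icc 0 T)) : Continuous f := by
  refine continuous_iff_continuousAt.2 fun t => ?_
  refine (h (t + 1) (by positivity)).continuousAt ?_
  filter_upwards [Iic_mem_nhds (lt_add_one t)] with s hs using ⟨zero_le, hs⟩

theorem IsQV.sumsTo {X : ℝ≥0 → ℝ} (h : IsQV 𝕋 X) (T : ℝ≥0) :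
    SumsTo 𝕋 (fun s u => incr X s u ^ 2) (quadVar 𝕋 X) T where
  bdd := BddSum.of_tendsto (fun _ _ => sq_nonneg _) (h.tendsto T)
  cont := h.continuous_quadVar.continuousOn
  tendsto t _ := h.tendsto t

theorem SumsTo.eq_quadVar {X M : ℝ≥0 → ℝ} (h : SumsTo 𝕋 (fun s u => incr X s u ^ 2) M T)
    {t : ℝ≥0} (ht : t ≤ T) : quadVar 𝕋 X t = M t :=
  (h.tendsto t ht).limUnder_eq

theorem SumsTo.quadVar {X M : ℝ≥0 → ℝ} (h : SumsTo 𝕋 (fun s u => incr X s u ^ 2) M T) :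
    SumsTo 𝕋 (fun s u => incr X s u ^ 2) (quadVar 𝕋 X) T :=
  h.congr (fun _ _ _ _ => rfl) fun _ ht => h.eq_quadVar ht

/-- The limit may be found separately on each horizon: uniqueness of limits identifies it with
`quadVar`, and continuity is local. The horizon `t + 1` makes the case `t = 0` fit the restriction
to positive horizons. -/
theorem isQV_of_sumsTo {X : ℝ≥0 → ℝ} (hc : Continuous X)
    (h : ∀ T, 0 < T → ∃ M, SumsTo 𝕋 (fun s u => incr X s u ^ 2) M T) : IsQV 𝕋 X where
  continuous := hc
  tendsto t := by
    obtain ⟨M, hM⟩ := h (t + 1) (by positivity)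
    exact hM.quadVar.tendsto t (lt_add_one t).le
  continuous_quadVar := continuous_of_continuousOn_Icc fun T hT => by
    obtain ⟨M, hM⟩ := h T hT
    exact hM.quadVar.cont

namespace IsQVVec

variable {X : ℝ≥0 → Fin d → ℝ}

/-- Taking `i = j` in the definition gives information on 2 X^i, whence the factor 1/4. -/
theorem sumsTo_sq (h : IsQVVec 𝕋 X) (T : ℝ≥0) (i : Fin d) :
    SumsTo 𝕋 (fun s u => incr (fun t => X t i) s u ^ 2)
      (fun t => 4⁻¹ * quadVar 𝕋 (fun t => X t i + X t i) t) T :=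
  (((h.add i i).sumsTo T).const_mul 4⁻¹).congr (fun s u _ _ => by simp only [incr]; ring)
    fun _ _ => rfl

/-- Polarization: 2 δX^i δX^j is the square of the sum minus the two squares. -/
theorem exists_sumsTo_mul (h : IsQVVec 𝕋 X) (T : ℝ≥0) (i j : Fin d) :
    ∃ M, SumsTo 𝕋 (fun s u => incr (fun t => X t i) s u * incr (fun t => X t j) s u) M T :=
  ⟨_, (((((h.add i j).sumsTo T).sub (h.sumsTo_sq T i)).sub (h.sumsTo_sq T j)).const_mul
    2⁻¹).congr (fun s u _ _ => by simp only [incr]; ring) fun _ _ => rfl⟩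

theorem continuous_apply (h : IsQVVec 𝕋 X) (i : Fin d) : Continuous fun t => X t i :=
  (_root_.continuous_apply i).comp h.continuous

theorem bddSum_norm_sq (h : IsQVVec 𝕋 X) (T : ℝ≥0) :
    BddSum 𝕋 (fun s u => ‖X u - X s‖ ^ 2) T := by
  refine (BddSum.sum Finset.univ fun i _ => (h.sumsTo_sq T i).bdd).mono fun s u _ _ => ?_
  rw [abs_of_nonneg (by positivity), abs_of_nonneg (Finset.sum_nonneg fun _ _ => sq_nonneg _)]
  have hsum : 0 ≤ ∑ i, incr (fun t => X t i) s u ^ 2 := Finset.sum_nonneg fun _ _ => sq_nonneg _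
  rw [← Real.le_sqrt (norm_nonneg _) hsum, pi_norm_le_iff_of_nonneg (Real.sqrt_nonneg _)]
  intro i
  rw [Real.norm_eq_abs]
  refine Real.abs_le_sqrt ?_
  exact Finset.single_le_sum (f := fun i => incr (fun t => X t i) s u ^ 2)
    (fun _ _ => sq_nonneg _) (Finset.mem_univ i)

end IsQVVec

/-- `ξ_s · (X_u - X_s)`. -/
def dotIncr (ξ X : ℝ≥0 → Fin d → ℝ) : ℝ≥0 → ℝ≥0 → ℝ := fun s u => ξ s ⬝ᵥ (X u - X s)

theorem dotIncr_eq_sum (ξ X : ℝ≥0 → Fin d → ℝ) (s u : ℝ≥0) :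
    dotIncr ξ X s u = ∑ i, ξ s i * incr (fun t => X t i) s u := rfl

theorem UnifSmall.dotIncr {X ξ : ℝ≥0 → Fin d → ℝ} (hX : ContinuousOn X (Icc 0 T))
    (hξ : ContinuousOn ξ (Icc 0 T)) : UnifSmall 𝕋 (dotIncr ξ X) T := by
  simp only [funext₂ (dotIncr_eq_sum ξ X)]
  exact UnifSmall.sum _ fun i _ =>
    (UnifSmall.incr (continuousOn_pi.1 hX i)).mul (continuousOn_pi.1 hξ i)

theorem IsQVVec.exists_sumsTo_dotIncr_sq {X ξ : ℝ≥0 → Fin d → ℝ} (h : IsQVVec 𝕋 X)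
    (hξ : ContinuousOn ξ (Icc 0 T)) :
    ∃ M, SumsTo 𝕋 (fun s u => PathwiseIto.dotIncr ξ X s u ^ 2) M T := by
  have hij : ∀ i j, ∃ M, SumsTo 𝕋 (fun s u => (ξ s i * ξ s j) *
      (incr (fun t => X t i) s u * incr (fun t => X t j) s u)) M T := fun i j => by
    obtain ⟨M, hM⟩ := h.exists_sumsTo_mul T i j
    obtain ⟨I, hI, -⟩ := hM.exists_mul (g := fun s => ξ s i * ξ s j)
      ((continuousOn_pi.1 hξ i).mul (continuousOn_pi.1 hξ j))
    exact ⟨I, hI⟩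
  choose I hI using hij
  refine ⟨_, (SumsTo.sum Finset.univ fun i _ => SumsTo.sum Finset.univ fun j _ =>
    hI i j).congr (fun s u _ _ => ?_) fun _ _ => rfl⟩
  rw [dotIncr_eq_sum, pow_two, Finset.sum_mul_sum]
  exact Finset.sum_congr rfl fun i _ => Finset.sum_congr rfl fun j _ => by ring

/-- A function whose increments are close to `ξ · δX` in the square sense has a quadratic
variation. -/
theorem IsQVVec.exists_sumsTo_sq {X ξ : ℝ≥0 → Fin d → ℝ} {Z : ℝ≥0 → ℝ} (h : IsQVVec 𝕋 X)
    (hξ : ContinuousOn ξ (Icc 0 T))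
    (hZ : AbsNegl 𝕋 (fun s u => (incr Z s u - PathwiseIto.dotIncr ξ X s u) ^ 2) T) :
    ∃ M, SumsTo 𝕋 (fun s u => incr Z s u ^ 2) M T := by
  obtain ⟨M, hM⟩ := h.exists_sumsTo_dotIncr_sq hξ
  exact ⟨M, (hM.add_negl (hZ.sq_sub_sq hM.bdd).negl).congr (fun _ _ _ _ => by ring)
    fun _ _ => rfl⟩

/-- The difference of the two increments is also uniformly small by continuity, so its square has
vanishing sums and `Z` inherits the quadratic variation of the sums of ξ · δX. -/
theorem IsQVVec.exists_sumsTo_sq_of_negl {X ξ : ℝ≥0 → Fin d → ℝ} {Z : ℝ≥0 → ℝ}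
    (h : IsQVVec 𝕋 X) (hξ : ContinuousOn ξ (Icc 0 T)) (hZc : ContinuousOn Z (Icc 0 T))
    (hZ : Negl 𝕋 (fun s u => incr Z s u - PathwiseIto.dotIncr ξ X s u) T) :
    ∃ M, SumsTo 𝕋 (fun s u => incr Z s u ^ 2) M T :=
  h.exists_sumsTo_sq hξ
    (hZ.absNegl_sq ((UnifSmall.incr hZc).sub (.dotIncr h.continuous.continuousOn hξ)))

end PathwiseIto

/-! ### Taylor remainders along the partitions -/

/-- Second-order Taylor estimate with modulus of continuity of the second derivative. -/
theorem abs_sub_taylor_two_le {E : Type*} [NormedAddCommGroup E] [NormedSpace ℝ E] {φ : E → ℝ}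
    {φ' : E → E →L[ℝ] ℝ} {φ'' : E → E →L[ℝ] E →L[ℝ] ℝ} {C : Set E} (hC : Convex ℝ C)
    (h1 : ∀ z ∈ C, HasFDerivAt φ (φ' z) z) (h2 : ∀ z ∈ C, HasFDerivAt φ' (φ'' z) z)
    {x y : E} (hx : x ∈ C) (hy : y ∈ C) {ε : ℝ}
    (hε : ∀ z ∈ segment ℝ x y, ‖φ'' z - φ'' x‖ ≤ ε) :
    |φ y - φ x - φ' x (y - x) - 2⁻¹ * φ'' x (y - x) (y - x)| ≤ ε * ‖y - x‖ ^ 2 := by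
  have hseg : segment ℝ x y ⊆ C := hC.segment_subset hx hy
  have hε0 : 0 ≤ ε := (norm_nonneg (φ'' x - φ'' x)).trans (hε x (left_mem_segment ℝ x y))
  -- The mean value inequality is applied twice: here to φ', then to ψ, which is φ along the segment
  -- minus its quadratic Taylor polynomial.
  have hG : ∀ z ∈ segment ℝ x y, ‖φ' z - φ' x - φ'' x (z - x)‖ ≤ ε * ‖y - x‖ := by
    intro z hz
    refine ((convex_segment x y).norm_image_sub_le_of_norm_hasFDerivWithin_le'
      (fun w hw => (h2 w (hseg hw)).hasFDerivWithinAt) hε (left_mem_segment ℝ x y) hz).trans ?_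
    exact mul_le_mul_of_nonneg_left (norm_sub_le_of_mem_segment hz) hε0
  have hmem : ∀ τ ∈ Icc (0 : ℝ) 1, x + τ • (y - x) ∈ segment ℝ x y := fun τ hτ => by
    rw [segment_eq_image']; exact ⟨τ, hτ, rfl⟩
  set ψ : ℝ → ℝ := fun τ => φ (x + τ • (y - x)) - τ * φ' x (y - x) -
    2⁻¹ * τ ^ 2 * φ'' x (y - x) (y - x) with hψ
  have hline : ∀ τ : ℝ, HasDerivAt (fun τ : ℝ => x + τ • (y - x)) (y - x) τ := fun τ => by
    simpa using ((hasDerivAt_id τ).smul_const (y - x)).const_add x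
  have hd : ∀ τ ∈ Icc (0 : ℝ) 1, HasDerivWithinAt ψ
      ((φ' (x + τ • (y - x)) - φ' x - φ'' x ((x + τ • (y - x)) - x)) (y - x)) (Icc 0 1) τ := by
    intro τ hτ
    have e1 := (h1 _ (hseg (hmem τ hτ))).comp_hasDerivAt τ (hline τ)
    have e2 := (e1.sub ((hasDerivAt_id τ).mul_const (φ' x (y - x)))).sub
      ((((hasDerivAt_id τ).pow 2).const_mul 2⁻¹).mul_const (φ'' x (y - x) (y - x)))
    refine (e2.congr_deriv ?_).hasDerivWithinAt
    simp
  have := norm_image_sub_le_of_norm_deriv_le_segment_01' (C := ε * ‖y - x‖ ^ 2) hd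
    fun τ hτ => by
      refine (ContinuousLinearMap.le_opNorm _ _).trans ?_
      rw [pow_two, ← mul_assoc]
      exact mul_le_mul_of_nonneg_right (hG _ (hmem τ (Ico_subset_Icc_self hτ))) (norm_nonneg _)
  rw [Real.norm_eq_abs] at this
  convert this using 2
  simp [hψ]
  ring

namespace PathwiseIto

variable {d : ℕ} {𝕋 : RefiningSequence} {Γ Γ' : ℝ≥0 → ℝ≥0 → ℝ} {T : ℝ≥0}

theorem eventually_norm_incr_lt {E : Type*} [NormedAddCommGroup E] {Y : ℝ≥0 → E}
    (hY : ContinuousOn Y (Icc 0 T)) {ε : ℝ} (hε : 0 < ε) :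
    ∀ᶠ n in atTop, ∀ k ∈ (𝕋.part n).indices T,
      ‖Y ((𝕋.part n).time (k + 1)) - Y ((𝕋.part n).time k)‖ < ε := by
  have h := isCompact_Icc.uniformContinuousOn_of_continuous hY
  rw [Metric.uniformContinuousOn_iff] at h
  obtain ⟨δ, hδ, h⟩ := h ε hε
  filter_upwards [𝕋.eventually_dist_lt hδ] with n hn k hk
  have hk' := Partition.mem_indices.1 hk
  rw [← dist_eq_norm]
  exact h _ ⟨zero_le, hk'⟩ _ ⟨zero_le, ((𝕋.part n).time_lt_succ k).le.trans hk'⟩ (hn k)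

/-- The remainder of the second-order Taylor expansion in the first variable is negligible. -/
theorem AbsNegl.taylor_two {E P : Type*} [NormedAddCommGroup E] [NormedSpace ℝ E]
    [PseudoMetricSpace P] {f : E × P → ℝ} {f' : E × P → E →L[ℝ] ℝ}
    {f'' : E × P → E →L[ℝ] E →L[ℝ] ℝ} {C : Set E} {D : Set P} (hC : Convex ℝ C)
    (hCc : IsCompact C) (hDc : IsCompact D)
    (h1 : ∀ x ∈ C, ∀ a ∈ D, HasFDerivAt (fun y => f (y, a)) (f' (x, a)) x)
    (h2 : ∀ x ∈ C, ∀ a ∈ D, HasFDerivAt (fun y => f' (y, a)) (f'' (x, a)) x)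
    (h3 : ContinuousOn f'' (C ×ˢ D)) {X : ℝ≥0 → E} {A : ℝ≥0 → P}
    (hX : ContinuousOn X (Icc 0 T)) (hXC : ∀ s ≤ T, X s ∈ C) (hAD : ∀ s ≤ T, A s ∈ D)
    (hb : BddSum 𝕋 (fun s u => ‖X u - X s‖ ^ 2) T) :
    AbsNegl 𝕋 (fun s u => f (X u, A s) - f (X s, A s) - f' (X s, A s) (X u - X s) -
      2⁻¹ * f'' (X s, A s) (X u - X s) (X u - X s)) T := by
  refine AbsNegl.of_small hb fun ε hε => ?_
  have huc := (hCc.prod hDc).uniformContinuousOn_of_continuous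
    (β := E →L[ℝ] E →L[ℝ] ℝ) h3
  obtain ⟨δ, hδ, huc⟩ := (Metric.uniformContinuousOn_iff
    (α := E × P) (β := E →L[ℝ] E →L[ℝ] ℝ)).1 huc ε hε
  filter_upwards [eventually_norm_incr_lt (𝕋 := 𝕋) hX hδ] with n hn k hk
  have hu := Partition.mem_indices.1 hk
  have hs := ((𝕋.part n).time_lt_succ k).le.trans hu
  have hnk := hn k hk
  set s := (𝕋.part n).time k
  set u := (𝕋.part n).time (k + 1)
  rw [abs_of_nonneg (a := ‖X u - X s‖ ^ 2) (by positivity)]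
  refine abs_sub_taylor_two_le hC (φ := fun y => f (y, A s)) (φ' := fun y => f' (y, A s))
    (φ'' := fun y => f'' (y, A s)) (fun z hz => h1 z hz _ (hAD s hs))
    (fun z hz => h2 z hz _ (hAD s hs)) (hXC s hs) (hXC u hu) fun z hz => ?_
  refine ((dist_eq_norm (f'' (z, A s)) (f'' (X s, A s))).symm.le).trans ?_
  refine (huc (z, A s) ⟨hC.segment_subset (hXC s hs) (hXC u hu) hz, hAD s hs⟩ (X s, A s)
    ⟨hXC s hs, hAD s hs⟩ ?_).le
  rw [Prod.dist_eq, dist_self, max_eq_left dist_nonneg, dist_eq_norm]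
  exact (norm_sub_le_of_mem_segment hz).trans_lt hnk

/-- The scalar case is the general one with a one-point parameter space. -/
theorem AbsNegl.taylor_two_real {φ φ₁ φ₂ : ℝ → ℝ} {a b : ℝ}
    (h1 : ∀ x ∈ Icc a b, HasDerivAt φ (φ₁ x) x) (h2 : ∀ x ∈ Icc a b, HasDerivAt φ₁ (φ₂ x) x)
    (h3 : ContinuousOn φ₂ (Icc a b)) {Y : ℝ≥0 → ℝ} (hY : ContinuousOn Y (Icc 0 T))
    (hYab : ∀ s ≤ T, Y s ∈ Icc a b) (hb : BddSum 𝕋 (fun s u => incr Y s u ^ 2) T) :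
    AbsNegl 𝕋 (fun s u => incr (fun t => φ (Y t)) s u - φ₁ (Y s) * incr Y s u -
      2⁻¹ * (φ₂ (Y s) * incr Y s u ^ 2)) T := by
  refine (AbsNegl.taylor_two (E := ℝ) (P := Unit) (f := fun p => φ p.1)
    (f' := fun p => φ₁ p.1 • (1 : ℝ →L[ℝ] ℝ))
    (f'' := fun p => φ₂ p.1 • (1 : ℝ →L[ℝ] ℝ).smulRight (1 : ℝ →L[ℝ] ℝ))
    (C := Icc a b) (D := univ) (A := fun _ => ()) (convex_Icc a b) isCompact_Icc isCompact_univ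
    (fun x hx _ _ => ?_) (fun x hx _ _ => ?_) ?_ hY hYab (fun _ _ => mem_univ _) ?_).congr
    fun s u _ _ => ?_
  · refine (h1 x hx).hasFDerivAt.congr_fderiv ?_
    ext; simp
  · have := (h2 x hx).hasFDerivAt.smul_const (1 : ℝ →L[ℝ] ℝ)
    refine this.congr_fderiv ?_
    ext; simp
  · have hc : ContinuousOn (fun p : ℝ × Unit => φ₂ p.1) (Icc a b ×ˢ univ) :=
      h3.comp continuousOn_fst fun p hp => hp.1
    exact hc.smul continuousOn_const
  · refine hb.mono fun s u _ _ => ?_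
    rw [incr, Real.norm_eq_abs, sq_abs]
  · simp [incr]
    left
    ring

/-- The remainder of the first-order expansion in the second variable is negligible. -/
theorem AbsNegl.taylor_one {E F : Type*} [NormedAddCommGroup E] [NormedSpace ℝ E]
    [NormedAddCommGroup F] [NormedSpace ℝ F] {f : E × F → ℝ} (hf : ContDiff ℝ 1 f)
    {C : Set E} {D : Set F} (hCc : IsCompact C) (hDc : IsCompact D) (hD : Convex ℝ D)
    {X : ℝ≥0 → E} {A : ℝ≥0 → F} (hX : ContinuousOn X (Icc 0 T)) (hA : ContinuousOn A (Icc 0 T))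
    (hXC : ∀ s ≤ T, X s ∈ C) (hAD : ∀ s ≤ T, A s ∈ D)
    (hb : BddSum 𝕋 (fun s u => ‖A u - A s‖) T) :
    AbsNegl 𝕋 (fun s u => f (X u, A u) - f (X u, A s) -
      fderiv ℝ f (X s, A s) (0, A u - A s)) T := by
  refine AbsNegl.of_small hb fun ε hε => ?_
  have huc := (hCc.prod hDc).uniformContinuousOn_of_continuous
    (hf.continuous_fderiv one_ne_zero).continuousOn
  rw [Metric.uniformContinuousOn_iff] at huc
  obtain ⟨δ, hδ, huc⟩ := huc ε hε
  filter_upwards [eventually_norm_incr_lt (𝕋 := 𝕋) hX hδ,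
    eventually_norm_incr_lt (𝕋 := 𝕋) hA hδ] with n hn1 hn2 k hk
  have hu := Partition.mem_indices.1 hk
  have hs := ((𝕋.part n).time_lt_succ k).le.trans hu
  have hk1 := hn1 k hk
  have hk2 := hn2 k hk
  set s := (𝕋.part n).time k
  set u := (𝕋.part n).time (k + 1)
  rw [abs_of_nonneg (a := ‖A u - A s‖) (by positivity)]
  have hseg := hD.segment_subset (hAD s hs) (hAD u hu)
  have hfd : ∀ p, HasFDerivAt f (fderiv ℝ f p) p := fun p =>
    (hf.differentiable one_ne_zero p).hasFDerivAt
  -- The function is taken at `X u` but its derivative at `X s`; uniform continuity of the joint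
  -- derivative absorbs the change in both variables.
  have := (convex_segment (𝕜 := ℝ) (A s) (A u)).norm_image_sub_le_of_norm_hasFDerivWithin_le'
    (f := fun a => f (X u, a))
    (f' := fun a => (fderiv ℝ f (X u, a)).comp (ContinuousLinearMap.inr ℝ E F))
    (φ := (fderiv ℝ f (X s, A s)).comp (ContinuousLinearMap.inr ℝ E F)) (C := ε)
    (fun a _ => ((hfd (X u, a)).comp a (hasFDerivAt_prodMk_right (X u) a)).hasFDerivWithinAt)
    (fun a ha => ?_) (left_mem_segment ℝ _ _) (right_mem_segment ℝ _ _)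
  · simpa using this
  · rw [← ContinuousLinearMap.sub_comp]
    refine (ContinuousLinearMap.opNorm_comp_le _ _).trans ?_
    have hle : ‖ContinuousLinearMap.inr ℝ E F‖ ≤ 1 := ContinuousLinearMap.norm_inr_le_one ℝ E F
    have hle2 : ‖fderiv ℝ f (X u, a) - fderiv ℝ f (X s, A s)‖ ≤ ε := by
      rw [← dist_eq_norm]
      refine (huc (X u, a) ⟨hXC u hu, hseg ha⟩ (X s, A s) ⟨hXC s hs, hAD s hs⟩ ?_).le
      rw [Prod.dist_eq, max_lt_iff, dist_eq_norm, dist_eq_norm]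
      exact ⟨hk1, (norm_sub_le_of_mem_segment ha).trans_lt hk2⟩
    calc _ ≤ ε * 1 := mul_le_mul hle2 hle (norm_nonneg _) hε.le
      _ = ε := mul_one ε

end PathwiseIto

namespace PathwiseIto

set_option maxSynthPendingDepth 3

/-! ### Functions of class `C^{1,0}` and `C^{2,1}` on open sets -/

/-- `g(x, a)` is continuous, and differentiable in `x` with a derivative continuous in `(x, a)`. -/
structure C10On {E F : Type*} [NormedAddCommGroup E] [NormedSpace ℝ E] [TopologicalSpace F]
    (g : E × F → ℝ) (O : Set (E × F)) : Prop where
  continuousOn : ContinuousOn g O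
  differentiableAt : ∀ p ∈ O, DifferentiableAt ℝ (fun x => g (x, p.2)) p.1
  continuousOn_fderiv : ContinuousOn (fun p : E × F => fderiv ℝ (fun x => g (x, p.2)) p.1) O

namespace C10On

variable {E F : Type*} [NormedAddCommGroup E] [NormedSpace ℝ E]

section Topological

variable [TopologicalSpace F] {g h : E × F → ℝ} {O O' : Set (E × F)}

theorem hasFDerivAt (hg : C10On g O) {p : E × F} (hp : p ∈ O) :
    HasFDerivAt (fun x => g (x, p.2)) (fderiv ℝ (fun x => g (x, p.2)) p.1) p.1 :=
  (hg.differentiableAt p hp).hasFDerivAt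

theorem of_hasFDerivAt {g' : E × F → E →L[ℝ] ℝ} (hg : ContinuousOn g O)
    (h1 : ∀ p ∈ O, HasFDerivAt (fun x => g (x, p.2)) (g' p) p.1) (h2 : ContinuousOn g' O) :
    C10On g O :=
  ⟨hg, fun p hp => (h1 p hp).differentiableAt, h2.congr fun p hp => (h1 p hp).fderiv⟩

theorem congr (hO : IsOpen O) (hg : C10On g O) (heq : EqOn h g O) : C10On h O := by
  have hev : ∀ p ∈ O, (fun x => h (x, p.2)) =ᶠ[𝓝 p.1] fun x => g (x, p.2) := by
    intro p hp
    have hc : Tendsto (fun x : E => (x, p.2)) (𝓝 p.1) (𝓝 p) :=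
      (Continuous.prodMk_left p.2).tendsto p.1
    exact (hc.eventually (hO.mem_nhds hp)).mono fun x hx => heq hx
  exact of_hasFDerivAt (hg.continuousOn.congr heq)
    (fun p hp => (hg.hasFDerivAt hp).congr_of_eventuallyEq (hev p hp)) hg.continuousOn_fderiv

theorem mono (hg : C10On g O) (hOO : O' ⊆ O) : C10On g O' :=
  ⟨hg.continuousOn.mono hOO, fun p hp => hg.differentiableAt p (hOO hp),
    hg.continuousOn_fderiv.mono hOO⟩

theorem of_locally (h : ∀ p ∈ O, ∃ V, IsOpen V ∧ p ∈ V ∧ C10On g V) : C10On g O where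
  continuousOn p hp := by
    obtain ⟨V, hV, hpV, hg⟩ := h p hp
    exact (hg.continuousOn.continuousAt (hV.mem_nhds hpV)).continuousWithinAt
  differentiableAt p hp := by
    obtain ⟨V, -, hpV, hg⟩ := h p hp
    exact hg.differentiableAt p hpV
  continuousOn_fderiv p hp := by
    obtain ⟨V, hV, hpV, hg⟩ := h p hp
    exact (hg.continuousOn_fderiv.continuousAt (hV.mem_nhds hpV)).continuousWithinAt

theorem mul (hg : C10On g O) (hh : C10On h O) : C10On (fun p => g p * h p) O :=
  of_hasFDerivAt (hg.continuousOn.mul hh.continuousOn)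
    (fun _ hp => (hg.hasFDerivAt hp).mul (hh.hasFDerivAt hp))
    ((hg.continuousOn.smul hh.continuousOn_fderiv).add
      (hh.continuousOn.smul hg.continuousOn_fderiv))

theorem add (hg : C10On g O) (hh : C10On h O) : C10On (fun p => g p + h p) O :=
  of_hasFDerivAt (hg.continuousOn.add hh.continuousOn)
    (fun _ hp => (hg.hasFDerivAt hp).add (hh.hasFDerivAt hp))
    (hg.continuousOn_fderiv.add hh.continuousOn_fderiv)

end Topological

variable [NormedAddCommGroup F] [NormedSpace ℝ F] {g h : E × F → ℝ} {O : Set (E × F)}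

theorem _root_.ContDiffOn.hasFDerivAt_fst {G : Type*} [NormedAddCommGroup G] [NormedSpace ℝ G]
    {g : E × F → G} (hO : IsOpen O) (hg : ContDiffOn ℝ 1 g O) {p : E × F}
    (hp : p ∈ O) : HasFDerivAt (fun x => g (x, p.2))
      ((fderiv ℝ g p).comp (ContinuousLinearMap.inl ℝ E F)) p.1 :=
  HasFDerivAt.comp (g := g) p.1
    ((hg.differentiableOn one_ne_zero).differentiableAt (hO.mem_nhds hp)).hasFDerivAt
    (hasFDerivAt_prodMk_left p.1 p.2)

theorem of_contDiffOn (hO : IsOpen O) (hg : ContDiffOn ℝ 1 g O) : C10On g O :=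
  of_hasFDerivAt hg.continuousOn (fun _ hp => hg.hasFDerivAt_fst hO hp)
    ((hg.continuousOn_fderiv_of_isOpen hO le_rfl).clm_comp continuousOn_const)

/-- The inner map φ is differentiated in x and must be `C^1`; the parameter is never differentiated,
so its change ψ only has to be continuous. -/
theorem comp {E' F' : Type*} [NormedAddCommGroup E'] [NormedSpace ℝ E'] [TopologicalSpace F']
    {g : E' × F' → ℝ} {V : Set (E' × F')} (hg : C10On g V) (hO : IsOpen O) {φ : E × F → E'}
    {ψ : F → F'} (hφ : ContDiffOn ℝ 1 φ O) (hψ : Continuous ψ)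
    (hV : MapsTo (fun p => (φ p, ψ p.2)) O V) : C10On (fun p => g (φ p, ψ p.2)) O := by
  have hc : ContinuousOn (fun p : E × F => (φ p, ψ p.2)) O :=
    hφ.continuousOn.prodMk (hψ.comp continuous_snd).continuousOn
  refine of_hasFDerivAt (g' := fun p => (fderiv ℝ (fun x => g (x, ψ p.2)) (φ p)).comp
    ((fderiv ℝ φ p).comp (ContinuousLinearMap.inl ℝ E F))) (hg.continuousOn.comp hc hV)
    (fun p hp => ?_) ?_
  · exact HasFDerivAt.comp (g := fun x => g (x, ψ p.2)) (f := fun x => φ (x, p.2)) p.1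
      (hg.hasFDerivAt (hV hp)) (hφ.hasFDerivAt_fst hO hp)
  · exact (hg.continuousOn_fderiv.comp hc hV).clm_comp
      ((hφ.continuousOn_fderiv_of_isOpen hO le_rfl).clm_comp continuousOn_const)

end C10On

variable {d : ℕ} {F : Type*} [NormedAddCommGroup F] [NormedSpace ℝ F]

/-- The partial derivative of `f(x, a)` with respect to `x^i`. -/
noncomputable def partialX {P : Type*} (f : (Fin d → ℝ) × P → ℝ) (i : Fin d)
    (p : (Fin d → ℝ) × P) : ℝ :=
  fderiv ℝ (fun x => f (x, p.2)) p.1 (Pi.single i 1)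

/-- `f(x, a)` is continuously differentiable and its partial derivatives with respect to `x` are
of class `C^{1,0}`. -/
structure C21On (f : (Fin d → ℝ) × F → ℝ) (O : Set ((Fin d → ℝ) × F)) : Prop where
  contDiffOn : ContDiffOn ℝ 1 f O
  partialX : ∀ i, C10On (partialX f i) O

theorem gradX_eq_partialX {n : ℕ} (f : (Fin d → ℝ) × (Fin n → ℝ) → ℝ) (x : Fin d → ℝ)
    (a : Fin n → ℝ) : gradX f x a = fun i => partialX f i (x, a) := rfl

/-- The `i`-th coordinate as a continuous linear functional. -/
noncomputable def coord (i : Fin d) : (Fin d → ℝ) →L[ℝ] ℝ := ContinuousLinearMap.proj i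

theorem eq_sum_smul_coord (L : (Fin d → ℝ) →L[ℝ] ℝ) :
    L = ∑ i, L (Pi.single i 1) • coord i := by
  ext x
  conv_lhs => rw [← Finset.univ_sum_single x]
  simp only [map_sum, sum_apply, smul_apply,
    coord, ContinuousLinearMap.proj_apply, smul_eq_mul]
  refine Finset.sum_congr rfl fun i _ => ?_
  rw [show Pi.single i (x i) = x i • (Pi.single i 1 : Fin d → ℝ) by
    rw [← Pi.single_smul, smul_eq_mul, mul_one], map_smul, smul_eq_mul, mul_comm]

variable {f g : (Fin d → ℝ) × F → ℝ} {O : Set ((Fin d → ℝ) × F)}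

theorem partialX_eq_of_contDiffOn (hO : IsOpen O) (hf : ContDiffOn ℝ 1 f O)
    {p : (Fin d → ℝ) × F} (hp : p ∈ O) (i : Fin d) :
    partialX f i p = fderiv ℝ f p (Pi.single i 1, 0) := by
  rw [partialX, (hf.hasFDerivAt_fst hO hp).fderiv]
  rfl

theorem partialX_congr {P : Type*} [TopologicalSpace P] {f g : (Fin d → ℝ) × P → ℝ}
    {O : Set ((Fin d → ℝ) × P)} (hO : IsOpen O) (heq : EqOn f g O) (i : Fin d) :
    EqOn (partialX f i) (partialX g i) O := by
  intro p hp
  have hc : Tendsto (fun x : Fin d → ℝ => (x, p.2)) (𝓝 p.1) (𝓝 p) :=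
    (Continuous.prodMk_left p.2).tendsto p.1
  have hev : (fun x => f (x, p.2)) =ᶠ[𝓝 p.1] fun x => g (x, p.2) :=
    (hc.eventually (hO.mem_nhds hp)).mono fun x hx => heq hx
  rw [partialX, partialX, hev.fderiv_eq]

namespace C21On

theorem congr (hO : IsOpen O) (hg : C21On g O) (heq : EqOn f g O) : C21On f O :=
  ⟨hg.contDiffOn.congr heq, fun i => (hg.partialX i).congr hO (partialX_congr hO heq i)⟩

theorem of_locally (h : ∀ p ∈ O, ∃ V, IsOpen V ∧ p ∈ V ∧ C21On f V) : C21On f O where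
  contDiffOn p hp := by
    obtain ⟨V, hV, hpV, hf⟩ := h p hp
    exact (hf.contDiffOn.contDiffAt (hV.mem_nhds hpV)).contDiffWithinAt
  partialX i := C10On.of_locally fun p hp => by
    obtain ⟨V, hV, hpV, hf⟩ := h p hp
    exact ⟨V, hV, hpV, hf.partialX i⟩

theorem of_contDiff (hf : ContDiff ℝ 2 f) : C21On f univ where
  contDiffOn := (hf.of_le one_le_two).contDiffOn
  partialX i := by
    refine (C10On.of_contDiffOn (g := fun p => fderiv ℝ f p (Pi.single i 1, 0)) isOpen_univ
      ?_).congr isOpen_univ fun p hp =>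
        partialX_eq_of_contDiffOn isOpen_univ (hf.of_le one_le_two).contDiffOn hp i
    exact ((hf.fderiv_right (m := 1) (by norm_num [one_add_one_eq_two])).clm_apply
      contDiff_const).contDiffOn

theorem mono {O' : Set ((Fin d → ℝ) × F)} (hf : C21On f O) (h : O' ⊆ O) : C21On f O' :=
  ⟨hf.contDiffOn.mono h, fun i => (hf.partialX i).mono h⟩

/-- The partials of the product, f ∂ᵢg + g ∂ᵢf, stay of class `C^{1,0}` because f and g are
themselves `C^1`. This allows multiplication by a cutoff. -/
theorem mul (hO : IsOpen O) (hf : C21On f O) (hg : C21On g O) : C21On (fun p => f p * g p) O where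
  contDiffOn := hf.contDiffOn.mul hg.contDiffOn
  partialX i := by
    refine (((C10On.of_contDiffOn hO hf.contDiffOn).mul (hg.partialX i)).add
      ((C10On.of_contDiffOn hO hg.contDiffOn).mul (hf.partialX i))).congr hO fun p hp => ?_
    have h1 := (C10On.of_contDiffOn hO hf.contDiffOn).hasFDerivAt hp
    have h2 := (C10On.of_contDiffOn hO hg.contDiffOn).hasFDerivAt hp
    rw [PathwiseIto.partialX, (h1.fun_mul h2).fderiv]
    rfl

/-- A function of class `C^{2,1}` near a compact set coincides near this set with one that is of
class `C^{2,1}` everywhere. -/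
theorem exists_global [FiniteDimensional ℝ F] (hO : IsOpen O) (hf : C21On f O)
    {K : Set ((Fin d → ℝ) × F)} (hK : IsCompact K) (hKO : K ⊆ O) :
    ∃ g, C21On g univ ∧ ∀ p ∈ K, g =ᶠ[𝓝 p] f := by
  -- The cutoff vanishes near the complement of `O`, so χ f is regular everywhere, and it is 1 near
  -- `K`, so x-gradients on `K` are unchanged.
  obtain ⟨χ, h0, h1, -⟩ := exists_contMDiffMap_zero_one_nhds_of_isClosed
    (modelWithCornersSelf ℝ ((Fin d → ℝ) × F)) (n := 2) hO.isClosed_compl hK.isClosed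
    (disjoint_compl_left_iff_subset.2 hKO)
  have hχ : ContDiff ℝ 2 χ := χ.contMDiff.contDiff
  refine ⟨fun p => χ p * f p, of_locally fun p _ => ?_, fun p hp => ?_⟩
  · by_cases hp : p ∈ O
    · exact ⟨O, hO, hp, ((of_contDiff hχ).mono (subset_univ _)).mul hO hf⟩
    · obtain ⟨V, hV, hVo, hpV⟩ := eventually_nhds_iff.1
        ((eventually_nhdsSet_iff_forall.1 h0) p hp)
      refine ⟨V, hVo, hpV, ((of_contDiff (f := fun _ => 0) contDiff_const).mono
        (subset_univ _)).congr hVo fun q hq => ?_⟩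
      simp [hV q hq]
  · filter_upwards [(eventually_nhdsSet_iff_forall.1 h1) p hp] with q hq
    rw [hq, one_mul]

theorem fderiv_section (hO : IsOpen O) (hf : C21On f O) {p : (Fin d → ℝ) × F} (hp : p ∈ O) :
    HasFDerivAt (fun x => f (x, p.2))
      (∑ i, PathwiseIto.partialX f i p • coord i) p.1 :=
  ((C10On.of_contDiffOn hO hf.contDiffOn).hasFDerivAt hp).congr_fderiv
    (eq_sum_smul_coord _)

/-- The second derivative of `f(x, a)` with respect to `x`. -/
noncomputable def secondX (f : (Fin d → ℝ) × F → ℝ) (p : (Fin d → ℝ) × F) :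
    (Fin d → ℝ) →L[ℝ] (Fin d → ℝ) →L[ℝ] ℝ :=
  ∑ i, (fderiv ℝ (fun x => PathwiseIto.partialX f i (x, p.2)) p.1).smulRight
    (coord i)

theorem hasFDerivAt_secondX (hf : C21On f O) {p : (Fin d → ℝ) × F} (hp : p ∈ O) :
    HasFDerivAt (fun x => ∑ i, PathwiseIto.partialX f i (x, p.2) •
      (coord i)) (secondX f p) p.1 :=
  HasFDerivAt.fun_sum fun i _ => ((hf.partialX i).hasFDerivAt hp).smul_const _

theorem continuousOn_secondX (hf : C21On f O) : ContinuousOn (secondX f) O :=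
  continuousOn_finsetSum _ fun i _ =>
    ((ContinuousLinearMap.smulRightL ℝ (Fin d → ℝ) ((Fin d → ℝ) →L[ℝ] ℝ)).flip
      (coord i)).continuous.comp_continuousOn
      (hf.partialX i).continuousOn_fderiv

end C21On

theorem IsC21On.c21On {n : ℕ} {f : (Fin d → ℝ) × (Fin n → ℝ) → ℝ} {U : Set (Fin d → ℝ)}
    {W : Set (Fin n → ℝ)} (hU : IsOpen U) (hW : IsOpen W) (hf : IsC21On f U W) :
    C21On f (U ×ˢ W) where
  contDiffOn := hf.contDiffOn_one
  partialX i := by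
    have hO := hU.prod hW
    have hd : ∀ p ∈ U ×ˢ W, HasFDerivAt (fun x => fderiv ℝ (fun y => f (y, p.2)) x)
        (fderiv ℝ (fun x => fderiv ℝ (fun y => f (y, p.2)) x) p.1) p.1 := by
      intro p hp
      have h2 := (hf.contDiffOn_two p.2 hp.2).fderiv_of_isOpen (m := 1) hU
        (by norm_num [one_add_one_eq_two])
      exact ((h2.differentiableOn one_ne_zero).differentiableAt
        (hU.mem_nhds hp.1)).hasFDerivAt
    refine C10On.of_hasFDerivAt (g' := fun p =>
      ((ContinuousLinearMap.apply ℝ ℝ (Pi.single i 1 : Fin d → ℝ)).comp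
        (fderiv ℝ (fun x => fderiv ℝ (fun y => f (y, p.2)) x) p.1))) ?_ (fun p hp => ?_) ?_
    · have hc := hf.contDiffOn_one.continuousOn_fderiv_of_isOpen hO le_rfl
      exact (hc.clm_apply continuousOn_const).congr fun p hp =>
        partialX_eq_of_contDiffOn hO hf.contDiffOn_one hp i
    · exact (ContinuousLinearMap.apply ℝ ℝ (Pi.single i 1 : Fin d → ℝ)).hasFDerivAt.comp p.1
        (hd p hp)
    · exact continuousOn_const.clm_comp hf.continuousOn_second

/-- The x-derivative is the sum of the partials times the coordinate functionals; differentiating it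
term by term gives `secondX`, which is jointly continuous. -/
theorem C21On.isC21On_univ {n : ℕ} {f : (Fin d → ℝ) × (Fin n → ℝ) → ℝ} (hf : C21On f univ) :
    IsC21On f univ univ := by
  have h1 : ∀ a : Fin n → ℝ, fderiv ℝ (fun x => f (x, a)) = fun x =>
      ∑ i, PathwiseIto.partialX f i (x, a) • coord i := fun a =>
    funext fun x => (hf.fderiv_section isOpen_univ (mem_univ (x, a))).fderiv
  have h2 : ∀ p, fderiv ℝ (fun x => fderiv ℝ (fun y => f (y, p.2)) x) p.1 =
      C21On.secondX f p := fun p => by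
    rw [show (fun x => fderiv ℝ (fun y => f (y, p.2)) x) = _ from h1 p.2]
    exact (hf.hasFDerivAt_secondX (mem_univ p)).fderiv
  refine ⟨by rw [univ_prod_univ]; exact hf.contDiffOn, fun a _ => ?_, ?_⟩
  · rw [contDiffOn_univ, show (2 : WithTop ℕ∞) = 1 + 1 by norm_num [one_add_one_eq_two],
      contDiff_succ_iff_fderiv]
    refine ⟨fun x => (hf.fderiv_section isOpen_univ (mem_univ (x, a))).differentiableAt,
      by simp, ?_⟩
    rw [contDiff_one_iff_fderiv]
    refine ⟨fun x => ?_, ?_⟩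
    · rw [h1]
      exact (hf.hasFDerivAt_secondX (mem_univ (x, a))).differentiableAt
    · have hc : Continuous (C21On.secondX f) := continuousOn_univ.1 hf.continuousOn_secondX
      exact (hc.comp (Continuous.prodMk_left a)).congr fun x => (h2 (x, a)).symm
  · rw [univ_prod_univ]
    exact hf.continuousOn_secondX.congr fun p _ => h2 p

end PathwiseIto

namespace PathwiseIto

set_option maxSynthPendingDepth 3

variable {d n : ℕ} {𝕋 : RefiningSequence} {Γ Γ' : ℝ≥0 → ℝ≥0 → ℝ} {T : ℝ≥0}
  {X ξ : ℝ≥0 → Fin d → ℝ} {A : ℝ≥0 → Fin n → ℝ}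

/-! ### The pathwise Itô formula -/

theorem exists_mem_closedBall {E : Type*} [NormedAddCommGroup E] {Y : ℝ≥0 → E}
    (hY : ContinuousOn Y (Icc 0 T)) : ∃ R, ∀ s ≤ T, Y s ∈ Metric.closedBall (0 : E) R := by
  obtain ⟨C, hC⟩ := isCompact_Icc.exists_bound_of_continuousOn hY
  exact ⟨C, fun s hs => by simpa using hC s ⟨zero_le, hs⟩⟩

theorem _root_.BoundedVariationOn.apply {α ι : Type*} [LinearOrder α] [Fintype ι]
    {f : α → ι → ℝ} {s : Set α} (hf : BoundedVariationOn f s) (i : ι) :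
    BoundedVariationOn (fun x => f x i) s :=
  (LipschitzWith.eval i).comp_boundedVariationOn hf

theorem bddSum_norm_of_boundedVariationOn (hA : BoundedVariationOn A (Icc 0 T)) :
    BddSum 𝕋 (fun s u => ‖A u - A s‖) T := by
  obtain ⟨C, hC⟩ : BddSum 𝕋 (fun s u => ∑ i, |incr (fun t => A t i) s u|) T :=
    BddSum.sum _ fun i _ => (BddSum.incr_of_boundedVariationOn (𝕋 := 𝕋) (hA.apply i)).mono
      fun s u _ _ => by rw [abs_abs]
  refine ⟨C, fun m => (partSum_le (T := T) le_rfl fun s u _ _ => ?_).trans (hC m)⟩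
  have h0 : 0 ≤ ∑ i, |incr (fun t => A t i) s u| := Finset.sum_nonneg fun _ _ => abs_nonneg _
  rw [abs_norm, abs_of_nonneg h0, pi_norm_le_iff_of_nonneg h0]
  exact fun i => Finset.single_le_sum (f := fun i => |incr (fun t => A t i) s u|)
    (fun _ _ => abs_nonneg _) (Finset.mem_univ i)

/-- Pathwise Itô formula: up to a continuous function of bounded variation, `f(X, A)` is the
integral of its gradient along `X`. -/
theorem IsQVVec.exists_ito (hX : IsQVVec 𝕋 X) {f : (Fin d → ℝ) × (Fin n → ℝ) → ℝ}
    (hf : C21On f univ) (hA : BoundedVariationOn A (Icc 0 T))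
    (hAc : ContinuousOn A (Icc 0 T)) :
    ∃ B : ℝ≥0 → ℝ, ContinuousOn B (Icc 0 T) ∧ BoundedVariationOn B (Icc 0 T) ∧
      Negl 𝕋 (fun s u => incr (fun t => f (X t, A t) + B t) s u -
        dotIncr (fun t => gradX f (X t) (A t)) X s u) T := by
  have hf1 : ContDiff ℝ 1 f := contDiffOn_univ.1 hf.contDiffOn
  have hXA : ContinuousOn (fun t => (X t, A t)) (Icc 0 T) :=
    hX.continuous.continuousOn.prodMk hAc
  obtain ⟨R, hR⟩ := exists_mem_closedBall (T := T) hX.continuous.continuousOn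
  obtain ⟨R', hR'⟩ := exists_mem_closedBall hAc
  have htwo := AbsNegl.taylor_two (𝕋 := 𝕋) (T := T) (f := f)
    (f' := fun p => ∑ i, partialX f i p • coord i) (f'' := C21On.secondX f)
    (convex_closedBall (0 : Fin d → ℝ) R) (isCompact_closedBall 0 R)
    (isCompact_closedBall (0 : Fin n → ℝ) R')
    (fun x _ a _ => hf.fderiv_section isOpen_univ (mem_univ (x, a)))
    (fun x _ a _ => hf.hasFDerivAt_secondX (mem_univ (x, a)))
    (hf.continuousOn_secondX.mono (subset_univ _)) hX.continuous.continuousOn hR hR'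
    (hX.bddSum_norm_sq T)
  have hone := AbsNegl.taylor_one (𝕋 := 𝕋) (T := T) hf1 (isCompact_closedBall (0 : Fin d → ℝ) R)
    (isCompact_closedBall (0 : Fin n → ℝ) R') (convex_closedBall (0 : Fin n → ℝ) R')
    hX.continuous.continuousOn hAc hR hR' (bddSum_norm_of_boundedVariationOn hA)
  have hM1 : ∃ M, SumsTo 𝕋 (fun s u => fderiv ℝ f (X s, A s) (0, A u - A s)) M T := by
    have hk : ∀ k, ∃ M, SumsTo 𝕋 (fun s u => fderiv ℝ f (X s, A s) (0, Pi.single k 1) *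
        incr (fun t => A t k) s u) M T := fun k => by
      obtain ⟨I, hI, -⟩ := (sumsTo_incr (𝕋 := 𝕋) (hA.apply k)
        (continuousOn_pi.1 hAc k)).exists_mul
        (g := fun s => fderiv ℝ f (X s, A s) (0, Pi.single k 1))
        (((hf1.continuous_fderiv one_ne_zero).comp_continuousOn hXA).clm_apply continuousOn_const)
      exact ⟨I, hI⟩
    choose I hI using hk
    refine ⟨_, (SumsTo.sum Finset.univ fun k _ => hI k).congr (fun s u _ _ => ?_) fun _ _ => rfl⟩
    have e := congrArg (fun L : (Fin n → ℝ) →L[ℝ] ℝ => L (A u - A s))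
      (eq_sum_smul_coord ((fderiv ℝ f (X s, A s)).comp (ContinuousLinearMap.inr ℝ _ _)))
    simpa [coord, incr] using e
  have hM2 : ∃ M, SumsTo 𝕋 (fun s u => C21On.secondX f (X s, A s) (X u - X s) (X u - X s))
      M T := by
    have hij : ∀ i j, ∃ M, SumsTo 𝕋 (fun s u =>
        fderiv ℝ (fun x => partialX f i (x, A s)) (X s) (Pi.single j 1) *
          (incr (fun t => X t j) s u * incr (fun t => X t i) s u)) M T := fun i j => by
      obtain ⟨M, hM⟩ := hX.exists_sumsTo_mul T j i
      obtain ⟨I, hI, -⟩ := hM.exists_mul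
        (g := fun s => fderiv ℝ (fun x => partialX f i (x, A s)) (X s) (Pi.single j 1))
        (((hf.partialX i).continuousOn_fderiv.comp hXA fun _ _ => mem_univ _).clm_apply
          continuousOn_const)
      exact ⟨I, hI⟩
    choose I hI using hij
    refine ⟨_, (SumsTo.sum Finset.univ fun i _ => SumsTo.sum Finset.univ fun j _ =>
      hI i j).congr (fun s u _ _ => ?_) fun _ _ => rfl⟩
    simp only [C21On.secondX, sum_apply, ContinuousLinearMap.smulRight_apply, smul_apply,
      smul_eq_mul]
    refine Finset.sum_congr rfl fun i _ => ?_
    have e := congrArg (fun L : (Fin d → ℝ) →L[ℝ] ℝ => L (X u - X s))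
      (eq_sum_smul_coord (fderiv ℝ (fun x => partialX f i (x, A s)) (X s)))
    simp only [sum_apply, smul_apply, smul_eq_mul] at e
    rw [e, Finset.sum_mul]
    exact Finset.sum_congr rfl fun j _ => by simp only [coord, incr]; exact mul_assoc _ _ _
  obtain ⟨M₁, hM₁⟩ := hM1
  obtain ⟨M₂, hM₂⟩ := hM2
  have hM := hM₁.add (hM₂.const_mul 2⁻¹)
  -- In Itô's formula δf ≈ ∇ₓ f · δX + δM₁ + δM₂ / 2, where M₁ integrates f_a against A and M₂
  -- integrates f_xx against the covariations; `B` moves these terms to the other side.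
  refine ⟨fun t => -1 * (M₁ t + 2⁻¹ * M₂ t), continuousOn_const.mul hM.cont,
    hM.boundedVariationOn.const_mul (-1), ?_⟩
  refine ((htwo.add hone).negl.add hM.negl_sub_incr).congr fun s u _ _ => ?_
  have e : (∑ i, partialX f i (X s, A s) • coord i) (X u - X s) =
      dotIncr (fun t => gradX f (X t) (A t)) X s u := by
    simp only [sum_apply, smul_apply, smul_eq_mul]
    rfl
  rw [e]
  simp only [incr]
  ring

/-- The path (X, A) over [0, T] is compact, so f can be replaced by a function defined everywhere
that agrees with it near the path; domains play no role afterwards. -/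
theorem IsAdmissibleIntegrand.exists_rep (hX : Continuous X) (h : IsAdmissibleIntegrand X ξ)
    (hT : 0 < T) :
    ∃ (n : ℕ) (f : (Fin d → ℝ) × (Fin n → ℝ) → ℝ) (A : ℝ≥0 → Fin n → ℝ),
      C21On f univ ∧ ContinuousOn A (Icc 0 T) ∧ BoundedVariationOn A (Icc 0 T) ∧
        ∀ t ≤ T, ξ t = gradX f (X t) (A t) := by
  obtain ⟨n, U, W, f, A, hU, hW, hf, hA, hξ⟩ := h T hT
  have hO := hU.prod hW
  have hK : IsCompact ((fun t => (X t, A t)) '' Icc 0 T) :=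
    isCompact_Icc.image_of_continuousOn (hX.continuousOn.prodMk hA.continuousOn)
  obtain ⟨g, hg, hgf⟩ := (hf.c21On hU hW).exists_global hO hK (by
    rintro _ ⟨t, ht, rfl⟩
    exact ⟨(hξ t ht).1, hA.mapsTo ht⟩)
  refine ⟨n, g, A, hg, hA.continuousOn, hA.boundedVariation, fun t ht => ?_⟩
  have ht' : t ∈ Icc 0 T := ⟨zero_le, ht⟩
  rw [(hξ t ht').2, gradX_eq_partialX, gradX_eq_partialX]
  obtain ⟨V, hV, hVo, htV⟩ := eventually_nhds_iff.1 (hgf _ ⟨t, ht', rfl⟩)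
  exact funext fun i => (partialX_congr hVo hV i htV).symm

theorem C21On.continuousOn_gradX {f : (Fin d → ℝ) × (Fin n → ℝ) → ℝ} (hf : C21On f univ)
    (hX : ContinuousOn X (Icc 0 T)) (hA : ContinuousOn A (Icc 0 T)) :
    ContinuousOn (fun t => gradX f (X t) (A t)) (Icc 0 T) :=
  continuousOn_pi.2 fun i => (hf.partialX i).continuousOn.comp (hX.prodMk hA)
    fun _ _ => mem_univ _

theorem IsAdmissibleIntegrand.continuous (hX : Continuous X) (h : IsAdmissibleIntegrand X ξ) :
    Continuous ξ := by
  refine continuous_of_continuousOn_Icc fun T hT => ?_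
  obtain ⟨n, f, A, hf, hAc, -, hξ⟩ := h.exists_rep hX hT
  exact (hf.continuousOn_gradX hX.continuousOn hAc).congr fun t ht => hξ t ht.2

/-- On `[0, T]` the integral of an admissible integrand is of the form `f(X, A) + B`. -/
theorem IsAdmissibleIntegrand.exists_ito (hX : IsQVVec 𝕋 X) (h : IsAdmissibleIntegrand X ξ)
    (hT : 0 < T) :
    ∃ (n : ℕ) (f : (Fin d → ℝ) × (Fin n → ℝ) → ℝ) (A : ℝ≥0 → Fin n → ℝ) (B : ℝ≥0 → ℝ),
      C21On f univ ∧ ContinuousOn A (Icc 0 T) ∧ BoundedVariationOn A (Icc 0 T) ∧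
        ContinuousOn B (Icc 0 T) ∧ BoundedVariationOn B (Icc 0 T) ∧
        (∀ t ≤ T, ξ t = gradX f (X t) (A t)) ∧
        Negl 𝕋 (fun s u => incr (fun t => f (X t, A t) + B t) s u - dotIncr ξ X s u) T := by
  obtain ⟨n, f, A, hf, hAc, hA, hξ⟩ := h.exists_rep hX.continuous hT
  obtain ⟨B, hBc, hB, hN⟩ := hX.exists_ito hf hA hAc
  refine ⟨n, f, A, B, hf, hAc, hA, hBc, hB, hξ, hN.congr fun s u hs hu => ?_⟩
  simp only [dotIncr, hξ s (hs.le.trans hu)]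

/-! ### The Föllmer integral -/

/-- `Z` is an indefinite integral of `ξ` along `X`. -/
structure IsIntegral (𝕋 : RefiningSequence) (ξ X : ℝ≥0 → Fin d → ℝ) (Z : ℝ≥0 → ℝ) : Prop where
  continuous : Continuous Z
  negl : ∀ T, Negl 𝕋 (fun s u => incr Z s u - dotIncr ξ X s u) T

theorem tendsto_riemannSum {Z : ℝ≥0 → ℝ} (hZ : ContinuousOn Z (Icc 0 T))
    (h : Negl 𝕋 (fun s u => incr Z s u - dotIncr ξ X s u) T) {t : ℝ≥0} (ht : t ≤ T) :
    Tendsto (fun n => riemannSum 𝕋 ξ X n t) atTop (𝓝 (Z t - Z 0)) := by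
  have := (tendsto_partSum_incr (𝕋 := 𝕋) hZ ht).sub (h.tendsto t ht)
  rw [sub_zero] at this
  refine this.congr fun n => ?_
  rw [partSum_sub, sub_sub_cancel]
  rfl

namespace IsIntegral

variable {Z : ℝ≥0 → ℝ}

theorem follmerIntegral_eq (h : IsIntegral 𝕋 ξ X Z) (t : ℝ≥0) :
    follmerIntegral 𝕋 ξ X t = Z t - Z 0 :=
  (tendsto_riemannSum h.continuous.continuousOn (h.negl t) le_rfl).limUnder_eq

theorem exists_integral (h : IsIntegral 𝕋 ξ X Z) : FollmerIntegralExists 𝕋 ξ X := fun t => by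
  rw [h.follmerIntegral_eq]
  exact tendsto_riemannSum h.continuous.continuousOn (h.negl t) le_rfl

theorem isQV (hX : IsQVVec 𝕋 X) (hξ : Continuous ξ) (h : IsIntegral 𝕋 ξ X Z) : IsQV 𝕋 Z :=
  isQV_of_sumsTo h.continuous fun T _ =>
    hX.exists_sumsTo_sq_of_negl hξ.continuousOn h.continuous.continuousOn (h.negl T)

theorem congr {ξ' X' : ℝ≥0 → Fin d → ℝ} (h : IsIntegral 𝕋 ξ X Z)
    (hN : ∀ T, Negl 𝕋 (fun s u => dotIncr ξ X s u - dotIncr ξ' X' s u) T) :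
    IsIntegral 𝕋 ξ' X' Z :=
  ⟨h.continuous, fun T => ((h.negl T).add (hN T)).congr fun _ _ _ _ => by ring⟩

end IsIntegral

/-- The representation f(X, A) + B depends on the horizon but the limit of the Riemann sums does
not. On each [0, T] they differ by a constant, so continuity and the increment relation carry over.
-/
theorem IsAdmissibleIntegrand.isIntegral (hX : IsQVVec 𝕋 X) (h : IsAdmissibleIntegrand X ξ) :
    IsIntegral 𝕋 ξ X (follmerIntegral 𝕋 ξ X) := by
  have key : ∀ T, 0 < T → ContinuousOn (PathwiseIto.follmerIntegral 𝕋 ξ X) (Icc 0 T) ∧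
      Negl 𝕋 (fun s u => incr (follmerIntegral 𝕋 ξ X) s u - dotIncr ξ X s u) T := by
    intro T hT
    obtain ⟨n, f, A, B, hf, hAc, -, hBc, -, -, hN⟩ := h.exists_ito hX hT
    have hZ : ContinuousOn (fun t => f (X t, A t) + B t) (Icc 0 T) :=
      (hf.contDiffOn.continuousOn.comp (hX.continuous.continuousOn.prodMk hAc)
        fun _ _ => mem_univ _).add hBc
    have heq : ∀ t ≤ T, follmerIntegral 𝕋 ξ X t = _ := fun t ht =>
      (tendsto_riemannSum hZ hN ht).limUnder_eq
    refine ⟨(hZ.sub continuousOn_const).congr fun t ht => heq t ht.2,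
      hN.congr fun s u hs hu => ?_⟩
    simp only [incr, heq u hu, heq s (hs.le.trans hu), sub_sub_sub_cancel_right]
  exact ⟨continuous_of_continuousOn_Icc fun T hT => (key T hT).1,
    fun T => (key (T + 1) (by positivity)).2.mono (le_add_of_nonneg_right zero_le_one)⟩

theorem follmerIntegral_zero : follmerIntegral 𝕋 ξ X 0 = 0 := by
  refine Tendsto.limUnder_eq (tendsto_const_nhds.congr fun n => ?_)
  exact (partSum_zero_time (𝕋 := 𝕋) (Γ := dotIncr ξ X) n).symm

theorem quadVar_zero (Z : ℝ≥0 → ℝ) : quadVar 𝕋 Z 0 = 0 := by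
  refine Tendsto.limUnder_eq (tendsto_const_nhds.congr fun n => ?_)
  exact (partSum_zero_time (𝕋 := 𝕋) (Γ := fun s u => incr Z s u ^ 2) n).symm

end PathwiseIto

namespace PathwiseIto

set_option maxSynthPendingDepth 3

variable {d : ℕ} {𝕋 : RefiningSequence} {Γ Γ' : ℝ≥0 → ℝ≥0 → ℝ} {T : ℝ≥0}

/-! ### Logarithms and exponentials -/

theorem exists_Icc_pos {Y : ℝ≥0 → ℝ} (hY : ContinuousOn Y (Icc 0 T)) (hpos : ∀ s ≤ T, 0 < Y s) :
    ∃ a b, 0 < a ∧ ∀ s ≤ T, Y s ∈ Icc a b := by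
  obtain ⟨x, hx, hmin⟩ := isCompact_Icc.exists_isMinOn ⟨0, left_mem_Icc.2 (zero_le (a := T))⟩ hY
  obtain ⟨C, -, hC⟩ := exists_abs_le hY
  exact ⟨Y x, C, hpos x hx.2, fun s hs => ⟨hmin ⟨zero_le, hs⟩, (le_abs_self _).trans (hC s hs)⟩⟩

section Log

variable {Y : ℝ≥0 → ℝ}

theorem continuousOn_inv_of_pos (hY : ContinuousOn Y (Icc 0 T)) (hpos : ∀ s ≤ T, 0 < Y s) :
    ContinuousOn (fun s => (Y s)⁻¹) (Icc 0 T) :=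
  hY.inv₀ fun s hs => (hpos s hs.2).ne'

/-- `δ log Y = δY / Y - (δY / Y)² / 2` up to a negligible remainder. -/
theorem AbsNegl.incr_log (hY : ContinuousOn Y (Icc 0 T)) (hpos : ∀ s ≤ T, 0 < Y s)
    (hb : BddSum 𝕋 (fun s u => incr Y s u ^ 2) T) :
    AbsNegl 𝕋 (fun s u => incr (fun t => Real.log (Y t)) s u - (Y s)⁻¹ * incr Y s u +
      2⁻¹ * ((Y s)⁻¹ * incr Y s u) ^ 2) T := by
  obtain ⟨a, b, ha, hab⟩ := exists_Icc_pos hY hpos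
  have hne : ∀ x ∈ Icc a b, x ≠ 0 := fun x hx => (ha.trans_le hx.1).ne'
  refine (AbsNegl.taylor_two_real (φ := Real.log) (φ₁ := fun x => x⁻¹)
    (φ₂ := fun x => -(x ^ 2)⁻¹) (fun x hx => Real.hasDerivAt_log (hne x hx))
    (fun x hx => hasDerivAt_inv (hne x hx))
    ((continuousOn_id.pow 2).inv₀ fun x hx => pow_ne_zero 2 (hne x hx)).neg hY hab hb).congr
    fun s u _ _ => ?_
  rw [mul_pow, inv_pow]
  ring

/-- The difference δ log Y - δY / Y has bounded absolute sums, being a negligible remainder minus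
(δY / Y)² / 2, and it is uniformly small. Its square is therefore negligible, and Cauchy-Schwarz
gives the difference of squares. -/
theorem AbsNegl.sq_incr_log (hY : ContinuousOn Y (Icc 0 T)) (hpos : ∀ s ≤ T, 0 < Y s)
    (hb : BddSum 𝕋 (fun s u => incr Y s u ^ 2) T) :
    AbsNegl 𝕋 (fun s u => incr (fun t => Real.log (Y t)) s u ^ 2 -
      ((Y s)⁻¹ * incr Y s u) ^ 2) T := by
  have hi := continuousOn_inv_of_pos hY hpos
  have hb' : BddSum 𝕋 (fun s u => ((Y s)⁻¹ * incr Y s u) ^ 2) T :=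
    (hb.mul (hi.pow 2)).mono fun s u _ _ => (congrArg _ (mul_pow _ _ _)).le
  have hlog : ContinuousOn (fun t => Real.log (Y t)) (Icc 0 T) :=
    hY.log fun s hs => (hpos s hs.2).ne'
  refine AbsNegl.sq_sub_sq (AbsNegl.sq ?_ ?_) hb'
  · exact ((AbsNegl.incr_log hY hpos hb).bdd.add (hb'.const_mul (-2⁻¹))).mono
      fun s u _ _ => le_of_eq (congrArg _ (by ring))
  · exact (UnifSmall.incr hlog).sub ((UnifSmall.incr hY).mul hi)

theorem exists_sumsTo_sq_log (hY : IsQV 𝕋 Y) (hpos : ∀ t, 0 < Y t) (T : ℝ≥0) :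
    ∃ M, SumsTo 𝕋 (fun s u => incr (fun t => Real.log (Y t)) s u ^ 2) M T := by
  have hc := hY.continuous.continuousOn (s := Icc 0 T)
  obtain ⟨I, hI, -⟩ := (hY.sumsTo T).exists_mul (g := fun s => ((Y s)⁻¹) ^ 2)
    ((continuousOn_inv_of_pos hc fun s _ => hpos s).pow 2)
  exact ⟨I, (hI.add_negl (AbsNegl.sq_incr_log hc (fun s _ => hpos s)
    (hY.sumsTo T).bdd).negl).congr (fun s u _ _ => by ring) fun _ _ => rfl⟩

theorem IsQV.log (hY : IsQV 𝕋 Y) (hpos : ∀ t, 0 < Y t) : IsQV 𝕋 (fun t => Real.log (Y t)) :=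
  isQV_of_sumsTo (hY.continuous.log fun t => (hpos t).ne') fun T _ =>
    exists_sumsTo_sq_log hY hpos T

theorem IsQV.continuous_itoLog (hY : IsQV 𝕋 Y) (hpos : ∀ t, 0 < Y t) :
    Continuous (itoLog 𝕋 Y) :=
  (hY.continuous.log fun t => (hpos t).ne').add ((hY.log hpos).continuous_quadVar.div_const 2)

/-- The Itô logarithm of `Y` is the integral of `1 / Y` along `Y`. -/
theorem IsQV.negl_itoLog (hY : IsQV 𝕋 Y) (hpos : ∀ t, 0 < Y t) (T : ℝ≥0) :
    Negl 𝕋 (fun s u => incr (itoLog 𝕋 Y) s u - (Y s)⁻¹ * incr Y s u) T := by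
  have hc := hY.continuous.continuousOn (s := Icc 0 T)
  have hb := (hY.sumsTo T).bdd
  have h1 := (AbsNegl.incr_log hc (fun s _ => hpos s) hb).negl
  have h2 := ((hY.log hpos).sumsTo T).negl_sub_incr.const_mul 2⁻¹
  have h3 := (AbsNegl.sq_incr_log hc (fun s _ => hpos s) hb).negl.const_mul 2⁻¹
  -- The second-order term (δY / Y)² is exchanged for (δ log Y)² and then for δ⟨log Y⟩, which is the
  -- correction in ℒ.
  refine ((h1.sub h2).add h3).congr fun s u _ _ => ?_
  simp only [incr, itoLog]
  ring

/-- A positive trajectory with `δV = V δZ` is the Doléans-Dade exponential of `Z`. -/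
theorem log_eq_of_negl {V Z : ℝ≥0 → ℝ} (hV : ContinuousOn V (Icc 0 T)) (hpos : ∀ s ≤ T, 0 < V s)
    (hb : BddSum 𝕋 (fun s u => incr V s u ^ 2) T) (hZ : IsQV 𝕋 Z)
    (h : Negl 𝕋 (fun s u => incr V s u - V s * incr Z s u) T) {t : ℝ≥0} (ht : t ≤ T) :
    Real.log (V t) - Z t + 2⁻¹ * quadVar 𝕋 Z t = Real.log (V 0) - Z 0 := by
  have hi := continuousOn_inv_of_pos hV hpos
  have hZc := hZ.continuous.continuousOn (s := Icc 0 T)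
  have hQ := (hZ.sumsTo T).cont
  have h1 := (AbsNegl.incr_log hV hpos hb).negl
  have h2 : Negl 𝕋 (fun s u => (V s)⁻¹ * incr V s u - incr Z s u) T :=
    (h.mul hi).congr fun s u hs hu => by
      have := (hpos s (hs.le.trans hu)).ne'
      field_simp
  have h3 := ((h2.absNegl_sq (((UnifSmall.incr hV).mul hi).sub (UnifSmall.incr hZc))).sq_sub_sq
    (hZ.sumsTo T).bdd).negl.const_mul 2⁻¹
  have h4 := (hZ.sumsTo T).negl_sub_incr.const_mul 2⁻¹
  have h5 : Negl 𝕋 (incr fun t => Real.log (V t) - Z t + 2⁻¹ * quadVar 𝕋 Z t) T := by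
    -- The squares cancel, leaving δ log V - δZ + δ⟨Z⟩ / 2.
    refine (((h1.add h2).sub h3).sub h4).congr fun s u _ _ => ?_
    simp only [incr]
    ring
  have := h5.eq_of_incr (((hV.log fun s hs => (hpos s hs.2).ne').sub hZc).add
    (continuousOn_const.mul hQ)) ht
  rw [this, quadVar_zero, mul_zero, add_zero]

end Log

theorem continuous_doleansDade {Z : ℝ≥0 → ℝ} (hZ : IsQV 𝕋 Z) : Continuous (doleansDade 𝕋 Z) :=
  Real.continuous_exp.comp (hZ.continuous.sub (hZ.continuous_quadVar.div_const 2))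

/-- The Doléans-Dade exponential solves `δV = V δZ`. -/
theorem negl_doleansDade {Z : ℝ≥0 → ℝ} (hZ : IsQV 𝕋 Z) (T : ℝ≥0) :
    Negl 𝕋 (fun s u => incr (doleansDade 𝕋 Z) s u - doleansDade 𝕋 Z s * incr Z s u) T := by
  set Y : ℝ≥0 → ℝ := fun t => Z t - quadVar 𝕋 Z t / 2 with hY
  have hYc : Continuous Y := hZ.continuous.sub (hZ.continuous_quadVar.div_const 2)
  have hVc : ContinuousOn (doleansDade 𝕋 Z) (Icc 0 T) := (continuous_doleansDade hZ).continuousOn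
  -- Here δY - δZ = -δ⟨Z⟩ / 2, and ⟨Z⟩ is continuous of bounded variation, so it has zero quadratic
  -- variation.
  have hQ : AbsNegl 𝕋 (fun s u => (incr Y s u - incr Z s u) ^ 2) T :=
    ((AbsNegl.sq_incr (hZ.sumsTo T).boundedVariationOn (hZ.sumsTo T).cont).const_mul 4⁻¹).congr
      fun s u _ _ => by simp only [incr, hY]; ring
  have hsq := hQ.sq_sub_sq (hZ.sumsTo T).bdd
  have hb : BddSum 𝕋 (fun s u => incr Y s u ^ 2) T :=
    (hsq.bdd.add (hZ.sumsTo T).bdd).mono fun s u _ _ => le_of_eq (congrArg _ (by ring))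
  obtain ⟨C, -, hC⟩ := exists_abs_le (hYc.continuousOn (s := Icc 0 T))
  have h1 : Negl 𝕋 (fun s u => incr (doleansDade 𝕋 Z) s u - doleansDade 𝕋 Z s * incr Y s u -
      2⁻¹ * (doleansDade 𝕋 Z s * incr Y s u ^ 2)) T :=
    (AbsNegl.taylor_two_real (fun x _ => Real.hasDerivAt_exp x)
      (fun x _ => Real.hasDerivAt_exp x) Real.continuous_exp.continuousOn hYc.continuousOn
      (fun s hs => abs_le.1 (hC s hs)) hb).negl
  have h2 := (hsq.negl.mul hVc).const_mul 2⁻¹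
  have h3 := ((hZ.sumsTo T).negl_sub_incr.mul hVc).const_mul 2⁻¹
  refine ((h1.add h2).add h3).congr fun s u _ _ => ?_
  simp only [incr, hY]
  ring

/-! ### The vector of Itô logarithms -/

section Vector

variable {S π : ℝ≥0 → Fin d → ℝ}

theorem IsQVVec.isQV_apply (h : IsQVVec 𝕋 S) (i : Fin d) : IsQV 𝕋 (fun t => S t i) :=
  isQV_of_sumsTo (h.continuous_apply i) fun T _ => ⟨_, h.sumsTo_sq T i⟩

theorem IsQVVec.isQV_log (h : IsQVVec 𝕋 S) (hpos : ∀ t i, 0 < S t i) (i : Fin d) :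
    IsQV 𝕋 (fun t => Real.log (S t i)) :=
  (h.isQV_apply i).log fun t => hpos t i

theorem continuous_ratio (hπ : Continuous π) (hS : Continuous S) (hpos : ∀ t i, 0 < S t i) :
    Continuous (ratio π S) :=
  continuous_pi fun i => ((continuous_apply i).comp hπ).div ((continuous_apply i).comp hS)
    fun t => (hpos t i).ne'

/-- `π · δℒ(S)` and `(π / S) · δS` agree up to a negligible remainder. -/
theorem IsQVVec.negl_dotIncr_itoLogVec (h : IsQVVec 𝕋 S) (hpos : ∀ t i, 0 < S t i)
    (hπ : Continuous π) (T : ℝ≥0) :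
    Negl 𝕋 (fun s u => dotIncr π (itoLogVec 𝕋 S) s u - dotIncr (ratio π S) S s u) T := by
  refine (Negl.sum Finset.univ fun i _ => ((h.isQV_apply i).negl_itoLog (fun t => hpos t i) T).mul
    (g := fun s => π s i) ((_root_.continuous_apply i).comp hπ).continuousOn).congr fun s u _ _ => ?_
  rw [dotIncr_eq_sum, dotIncr_eq_sum, ← Finset.sum_sub_distrib]
  refine Finset.sum_congr rfl fun i _ => ?_
  simp only [incr, itoLogVec, ratio]
  ring

theorem IsQVVec.itoLogVec (h : IsQVVec 𝕋 S) (hpos : ∀ t i, 0 < S t i) :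
    IsQVVec 𝕋 (itoLogVec 𝕋 S) := by
  have hc : ∀ i, Continuous fun t => PathwiseIto.itoLogVec 𝕋 S t i := fun i =>
    (h.isQV_apply i).continuous_itoLog fun t => hpos t i
  refine ⟨continuous_pi hc, fun i j => ?_⟩
  -- With this constant integrand π · δℒ(S) is the increment of ℒ(S^i) + ℒ(S^j), and it is
  -- comparable to (π / S) · δS.
  set π : ℝ≥0 → Fin d → ℝ := fun _ => Pi.single i 1 + Pi.single j 1 with hπdef
  have hπ : Continuous π := continuous_const
  refine isQV_of_sumsTo ((hc i).add (hc j)) fun T _ =>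
    h.exists_sumsTo_sq_of_negl (continuous_ratio hπ h.continuous hpos).continuousOn
      ((hc i).add (hc j)).continuousOn
      ((h.negl_dotIncr_itoLogVec hpos hπ T).congr fun s u _ _ => ?_)
  simp only [dotIncr, hπdef, add_dotProduct, single_one_dotProduct, Pi.sub_apply, incr]
  ring

end Vector

end PathwiseIto

namespace PathwiseIto

set_option maxSynthPendingDepth 3

variable {d n : ℕ} {𝕋 : RefiningSequence} {T : ℝ≥0}

/-! ### Construction of admissible integrands -/

/-- On `[0, T]` the function `ξ` is of the form `ξ_t = ∇ₓ f (X_t, A_t)`, as required for an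
admissible integrand. -/
def IsAdmissibleUpTo (X ξ : ℝ≥0 → Fin d → ℝ) (T : ℝ≥0) : Prop :=
  ∃ (n : ℕ) (U : Set (Fin d → ℝ)) (W : Set (Fin n → ℝ))
    (f : (Fin d → ℝ) × (Fin n → ℝ) → ℝ) (A : ℝ≥0 → Fin n → ℝ),
    IsOpen U ∧ IsOpen W ∧ IsC21On f U W ∧ IsCBVOn A T W ∧
      ∀ t ∈ Icc 0 T, X t ∈ U ∧ ξ t = gradX f (X t) (A t)

theorem IsAdmissibleUpTo.of_c21On {F : Type*} [NormedAddCommGroup F] [NormedSpace ℝ F]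
    [FiniteDimensional ℝ F] {h : (Fin d → ℝ) × F → ℝ} {O : Set ((Fin d → ℝ) × F)}
    (hO : IsOpen O) (hh : C21On h O) {X ξ : ℝ≥0 → Fin d → ℝ} {A : ℝ≥0 → F}
    (hX : ContinuousOn X (Icc 0 T)) (hA : ContinuousOn A (Icc 0 T))
    (hAv : BoundedVariationOn A (Icc 0 T)) (hXA : ∀ t ≤ T, (X t, A t) ∈ O)
    (hξ : ∀ t ≤ T, ∀ i, ξ t i = partialX h i (X t, A t)) : IsAdmissibleUpTo X ξ T := by
  obtain ⟨g, hg, hgh⟩ := hh.exists_global hO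
    (isCompact_Icc.image_of_continuousOn (hX.prodMk hA)) (by
      rintro _ ⟨t, ht, rfl⟩
      exact hXA t ht.2)
  -- Admissibility asks for parameters in a coordinate space; a linear isomorphism flattens `F` and
  -- preserves regularity and bounded variation.
  have e : F ≃L[ℝ] (Fin (Module.finrank ℝ F) → ℝ) :=
    ContinuousLinearEquiv.ofFinrankEq (by simp)
  have hf : C21On (fun p : (Fin d → ℝ) × (Fin (Module.finrank ℝ F) → ℝ) =>
      g (p.1, e.symm p.2)) univ := by
    refine ⟨?_, fun i => ?_⟩
    · have hg' : ContDiff ℝ 1 g := contDiffOn_univ.1 hg.contDiffOn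
      exact (hg'.comp (contDiff_fst.prodMk (e.symm.contDiff.comp contDiff_snd))).contDiffOn
    · exact (hg.partialX i).comp (φ := Prod.fst) (ψ := e.symm) isOpen_univ
        contDiff_fst.contDiffOn e.symm.continuous fun _ _ => mem_univ _
  refine ⟨_, univ, univ, _, fun t => e (A t), isOpen_univ, isOpen_univ, hf.isC21On_univ,
    ⟨fun _ _ => mem_univ _, e.continuous.comp_continuousOn hA,
      e.lipschitz.comp_boundedVariationOn hAv⟩, fun t ht => ⟨mem_univ _, funext fun i => ?_⟩⟩
  obtain ⟨V, hV, hVo, htV⟩ := eventually_nhds_iff.1 (hgh _ ⟨t, ht, rfl⟩)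
  rw [hξ t ht.2 i, ← partialX_congr hVo hV i htV, gradX_eq_partialX]
  simp only [partialX, ContinuousLinearEquiv.symm_apply_apply]

/-- The function `G (f (κ(x, c), a) + b)` of `x` and the parameters `(a, b, c)`. -/
def reparam (f : (Fin d → ℝ) × (Fin n → ℝ) → ℝ) (κ : ℝ × ℝ → ℝ) (G : ℝ → ℝ)
    (p : (Fin d → ℝ) × ((Fin n → ℝ) × ℝ × (Fin d → ℝ))) : ℝ :=
  G (f (fun i => κ (p.1 i, p.2.2.2 i), p.2.1) + p.2.2.1)

section Reparam

variable {f : (Fin d → ℝ) × (Fin n → ℝ) → ℝ} {κ κ₁ : ℝ × ℝ → ℝ} {G G₁ : ℝ → ℝ} {I J : Set ℝ}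

/-- By the chain rule each partial is a product of a partial of f, of class `C^{1,0}`, and of
factors built from `G₁` and `κ₁`, of class `C^1`. No more regularity of f in its parameter is
required. The set `O` is where the coordinates lie in the domain of κ and the inner value in that of
`G`. -/
theorem c21On_reparam (hf : C21On f univ) (hI : IsOpen I) (hJ : IsOpen J)
    (hκ : ContDiffOn ℝ 1 κ (I ×ˢ univ)) (hκ₁ : ContDiffOn ℝ 1 κ₁ (I ×ˢ univ))
    (hκd : ∀ x ∈ I, ∀ c, HasDerivAt (fun y => κ (y, c)) (κ₁ (x, c)) x)
    (hG : ContDiffOn ℝ 1 G J) (hG₁ : ContDiffOn ℝ 1 G₁ J)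
    (hGd : ∀ v ∈ J, HasDerivAt G (G₁ v) v) :
    ∃ O, IsOpen O ∧ O = {p | (∀ i, p.1 i ∈ I) ∧ reparam f κ id p ∈ J} ∧
      C21On (reparam f κ G) O ∧ ∀ p ∈ O, ∀ i, partialX (reparam f κ G) i p =
        G₁ (reparam f κ id p) * partialX f i (fun i => κ (p.1 i, p.2.2.2 i), p.2.1) *
          κ₁ (p.1 i, p.2.2.2 i) := by
  have hf1 : ContDiff ℝ 1 f := contDiffOn_univ.1 hf.contDiffOn
  set O₁ : Set ((Fin d → ℝ) × ((Fin n → ℝ) × ℝ × (Fin d → ℝ))) := {p | ∀ i, p.1 i ∈ I} with hO₁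
  have hO₁o : IsOpen O₁ := by
    simp only [hO₁, ofPred_forall]
    exact isOpen_iInter_of_finite fun i => hI.preimage (by fun_prop)
  have hcoord : ∀ i, ContDiff ℝ 1 fun p : (Fin d → ℝ) × ((Fin n → ℝ) × ℝ × (Fin d → ℝ)) =>
      (p.1 i, p.2.2.2 i) := fun i => by fun_prop
  have hΦ : ContDiffOn ℝ 1 (fun p : (Fin d → ℝ) × ((Fin n → ℝ) × ℝ × (Fin d → ℝ)) =>
      fun i => κ (p.1 i, p.2.2.2 i)) O₁ :=
    contDiffOn_pi.2 fun i => hκ.comp (hcoord i).contDiffOn fun p hp => ⟨hp i, mem_univ _⟩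
  have hin : ContDiffOn ℝ 1 (reparam f κ id) O₁ :=
    (hf1.comp_contDiffOn (hΦ.prodMk (by fun_prop))).add (by fun_prop)
  have hOo : IsOpen (O₁ ∩ reparam f κ id ⁻¹' J) := hin.continuousOn.isOpen_inter_preimage hO₁o hJ
  refine ⟨O₁ ∩ reparam f κ id ⁻¹' J, hOo, rfl, ?_⟩
  have hpart : ∀ p ∈ O₁ ∩ reparam f κ id ⁻¹' J, ∀ i, partialX (reparam f κ G) i p =
        G₁ (reparam f κ id p) * partialX f i (fun i => κ (p.1 i, p.2.2.2 i), p.2.1) *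
          κ₁ (p.1 i, p.2.2.2 i) := by
    intro p hp i
    have h1 : HasFDerivAt (fun x : Fin d → ℝ => fun j => κ (x j, p.2.2.2 j))
        (ContinuousLinearMap.pi fun j => κ₁ (p.1 j, p.2.2.2 j) • coord j) p.1 :=
      hasFDerivAt_pi.2 fun j => ((hκd _ (hp.1 j) (p.2.2.2 j)).comp_hasFDerivAt p.1
        (f := fun x : Fin d → ℝ => x j) (coord j).hasFDerivAt)
    have h2 := (hf.fderiv_section isOpen_univ
      (mem_univ ((fun i => κ (p.1 i, p.2.2.2 i), p.2.1) : (Fin d → ℝ) × (Fin n → ℝ)))).comp p.1 h1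
    have h3 : HasFDerivAt (fun x => reparam f κ G (x, p.2)) _ p.1 := (hGd _ hp.2).comp_hasFDerivAt p.1
      
      (f := fun x : Fin d → ℝ => f (fun i => κ (x i, p.2.2.2 i), p.2.1) + p.2.2.1) (h2.add_const p.2.2.1)
    rw [partialX, h3.fderiv]
    simp [coord, Pi.single_apply, mul_assoc]
  refine ⟨⟨?_, fun i => ?_⟩, hpart⟩
  · exact hG.comp (hin.mono inter_subset_left) fun p hp => hp.2
  · have hφ := hΦ.mono (inter_subset_left (t := reparam f κ id ⁻¹' J))
    have h1 := (hf.partialX i).comp (ψ := Prod.fst) hOo hφ continuous_fst fun _ _ => mem_univ _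
    have h2 : ContDiffOn ℝ 1 (fun p => G₁ (reparam f κ id p)) (O₁ ∩ reparam f κ id ⁻¹' J) :=
      hG₁.comp (hin.mono inter_subset_left) fun p hp => hp.2
    have h3 : ContDiffOn ℝ 1 (fun p : (Fin d → ℝ) × ((Fin n → ℝ) × ℝ × (Fin d → ℝ)) =>
        κ₁ (p.1 i, p.2.2.2 i)) (O₁ ∩ reparam f κ id ⁻¹' J) :=
      hκ₁.comp (hcoord i).contDiffOn fun p hp => ⟨hp.1 i, mem_univ _⟩
    exact (((C10On.of_contDiffOn hOo h2).mul h1).mul (C10On.of_contDiffOn hOo h3)).congr hOo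
      fun p hp => hpart p hp i

theorem IsAdmissibleUpTo.of_reparam (hf : C21On f univ) (hI : IsOpen I) (hJ : IsOpen J)
    (hκ : ContDiffOn ℝ 1 κ (I ×ˢ univ)) (hκ₁ : ContDiffOn ℝ 1 κ₁ (I ×ˢ univ))
    (hκd : ∀ x ∈ I, ∀ c, HasDerivAt (fun y => κ (y, c)) (κ₁ (x, c)) x)
    (hG : ContDiffOn ℝ 1 G J) (hG₁ : ContDiffOn ℝ 1 G₁ J)
    (hGd : ∀ v ∈ J, HasDerivAt G (G₁ v) v)
    {X Y ξ : ℝ≥0 → Fin d → ℝ} {A : ℝ≥0 → Fin n → ℝ} {b : ℝ≥0 → ℝ} {c : ℝ≥0 → Fin d → ℝ}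
    (hY : ContinuousOn Y (Icc 0 T)) (hA : ContinuousOn A (Icc 0 T))
    (hb : ContinuousOn b (Icc 0 T)) (hc : ContinuousOn c (Icc 0 T))
    (hAv : BoundedVariationOn A (Icc 0 T)) (hbv : BoundedVariationOn b (Icc 0 T))
    (hcv : BoundedVariationOn c (Icc 0 T))
    (hYI : ∀ t ≤ T, ∀ i, Y t i ∈ I) (hXY : ∀ t ≤ T, ∀ i, κ (Y t i, c t i) = X t i)
    (hXJ : ∀ t ≤ T, f (X t, A t) + b t ∈ J)
    (hξ : ∀ t ≤ T, ∀ i, ξ t i =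
      G₁ (f (X t, A t) + b t) * gradX f (X t) (A t) i * κ₁ (Y t i, c t i)) :
    IsAdmissibleUpTo Y ξ T := by
  obtain ⟨O, hO, hOeq, hC, hpart⟩ := c21On_reparam hf hI hJ hκ hκ₁ hκd hG hG₁ hGd
  have hX : ∀ t ≤ T, (fun i => κ (Y t i, c t i)) = X t := fun t ht => funext (hXY t ht)
  have hmem : ∀ t ≤ T, (Y t, (A t, b t, c t)) ∈ O := fun t ht => by
    rw [hOeq]
    refine ⟨hYI t ht, ?_⟩
    simpa only [reparam, hX t ht, id] using hXJ t ht
  refine .of_c21On hO hC (A := fun t => (A t, b t, c t)) hY (hA.prodMk (hb.prodMk hc))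
    (hAv.prodMk (hbv.prodMk hcv)) hmem fun t ht i => ?_
  rw [hpart _ (hmem t ht) i, hξ t ht i]
  simp only [reparam, hX t ht]
  rfl

end Reparam

end PathwiseIto

namespace PathwiseIto

set_option maxSynthPendingDepth 3

variable {d : ℕ} {𝕋 : RefiningSequence} {S π ξ : ℝ≥0 → Fin d → ℝ}

/-! ### Trading strategies and portfolio strategies -/

/-- Half of the quadratic variations of the logarithms. -/
noncomputable def halfLogVar (𝕋 : RefiningSequence) (S : ℝ≥0 → Fin d → ℝ) (t : ℝ≥0) : Fin d → ℝ :=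
  fun i => quadVar 𝕋 (fun s => Real.log (S s i)) t / 2

theorem itoLogVec_apply (t : ℝ≥0) (i : Fin d) :
    itoLogVec 𝕋 S t i = Real.log (S t i) + halfLogVar 𝕋 S t i := rfl

theorem continuous_halfLogVar (hS : IsQVVec 𝕋 S) (hpos : ∀ t i, 0 < S t i) :
    Continuous (halfLogVar 𝕋 S) :=
  continuous_pi fun i => (hS.isQV_log hpos i).continuous_quadVar.div_const 2

theorem boundedVariationOn_halfLogVar (hS : IsQVVec 𝕋 S) (hpos : ∀ t i, 0 < S t i) (T : ℝ≥0) :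
    BoundedVariationOn (halfLogVar 𝕋 S) (Icc 0 T) :=
  BoundedVariationOn.pi fun i => by
    have := ((hS.isQV_log hpos i).sumsTo T).boundedVariationOn.const_mul 2⁻¹
    simpa only [halfLogVar, div_eq_inv_mul] using this

theorem _root_.BoundedVariationOn.const {α E : Type*} [LinearOrder α] [PseudoEMetricSpace E]
    (c : E) (s : Set α) : BoundedVariationOn (fun _ => c) s := by
  simp [BoundedVariationOn, eVariationOn]

/-! ### From portfolio strategies to trading strategies -/

section Portfolio

theorem IsPortfolioStrategy.continuous (hS : IsQVVec 𝕋 S) (hpos : ∀ t i, 0 < S t i)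
    (h : IsPortfolioStrategy 𝕋 S π) : Continuous π :=
  h.admissible.continuous (hS.itoLogVec hpos).continuous

theorem IsPortfolioStrategy.isIntegral (hS : IsQVVec 𝕋 S) (hpos : ∀ t i, 0 < S t i)
    (h : IsPortfolioStrategy 𝕋 S π) :
    IsIntegral 𝕋 π (itoLogVec 𝕋 S) (follmerIntegral 𝕋 π (itoLogVec 𝕋 S)) :=
  h.admissible.isIntegral (hS.itoLogVec hpos)

theorem IsPortfolioStrategy.isQV (hS : IsQVVec 𝕋 S) (hpos : ∀ t i, 0 < S t i)
    (h : IsPortfolioStrategy 𝕋 S π) : IsQV 𝕋 (follmerIntegral 𝕋 π (itoLogVec 𝕋 S)) :=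
  (h.isIntegral hS hpos).isQV (hS.itoLogVec hpos) (h.continuous hS hpos)

theorem IsPortfolioStrategy.isIntegral_ratio (hS : IsQVVec 𝕋 S) (hpos : ∀ t i, 0 < S t i)
    (h : IsPortfolioStrategy 𝕋 S π) :
    IsIntegral 𝕋 (ratio π S) S (follmerIntegral 𝕋 π (itoLogVec 𝕋 S)) :=
  (h.isIntegral hS hpos).congr
    fun T => hS.negl_dotIncr_itoLogVec hpos (h.continuous hS hpos) T

theorem IsPortfolioStrategy.follmerIntegral_ratio (hS : IsQVVec 𝕋 S) (hpos : ∀ t i, 0 < S t i)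
    (h : IsPortfolioStrategy 𝕋 S π) :
    follmerIntegral 𝕋 (ratio π S) S = follmerIntegral 𝕋 π (itoLogVec 𝕋 S) :=
  funext fun t => by
    rw [(h.isIntegral_ratio hS hpos).follmerIntegral_eq, follmerIntegral_zero, sub_zero]

theorem contDiffOn_log_add : ContDiffOn ℝ 1 (fun p : ℝ × ℝ => Real.log p.1 + p.2)
    (Ioi 0 ×ˢ univ) :=
  (contDiffOn_fst.log fun _ hp => (ne_of_gt hp.1)).add contDiffOn_snd

theorem contDiffOn_inv_fst : ContDiffOn ℝ 1 (fun p : ℝ × ℝ => p.1⁻¹) (Ioi 0 ×ˢ univ) :=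
  contDiffOn_fst.inv fun _ hp => (ne_of_gt hp.1)

/-- The ratio `π / S` is an admissible integrand for `S`. -/
theorem IsPortfolioStrategy.admissible_ratio (hS : IsQVVec 𝕋 S) (hpos : ∀ t i, 0 < S t i)
    (h : IsPortfolioStrategy 𝕋 S π) : IsAdmissibleIntegrand S (ratio π S) := by
  intro T hT
  obtain ⟨n, g, A, hg, hAc, hA, hπ⟩ := h.admissible.exists_rep (hS.itoLogVec hpos).continuous hT
  -- π / S is the gradient of x ↦ g(log x + c, a), the factor 1 / x coming from the derivative of
  -- the logarithm; no outer function is needed.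
  refine IsAdmissibleUpTo.of_reparam (κ := fun p => Real.log p.1 + p.2) (κ₁ := fun p => p.1⁻¹)
    (G := id) (G₁ := fun _ => 1) (X := itoLogVec 𝕋 S) (b := fun _ => 0) hg isOpen_Ioi isOpen_univ
    contDiffOn_log_add contDiffOn_inv_fst
    (fun x hx c => (Real.hasDerivAt_log (ne_of_gt hx)).add_const c) contDiffOn_id contDiffOn_const
    (fun v _ => hasDerivAt_id v) hS.continuous.continuousOn hAc continuousOn_const
    (continuous_halfLogVar hS hpos).continuousOn hA (.const 0 _)
    (boundedVariationOn_halfLogVar hS hpos T) (fun t _ i => hpos t i) (fun t _ i => rfl)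
    (fun _ _ => mem_univ _) fun t ht i => ?_
  rw [ratio, hπ t ht, one_mul, div_eq_mul_inv]

theorem portfolioValue_pos (t : ℝ≥0) : 0 < portfolioValue 𝕋 S π t := Real.exp_pos _

theorem portfolioValue_zero : portfolioValue 𝕋 S π 0 = 1 := by
  rw [portfolioValue, doleansDade, follmerIntegral_zero, quadVar_zero]
  simp

/-- The trading strategy that corresponds to a portfolio strategy. -/
noncomputable def toTrading (𝕋 : RefiningSequence) (S π : ℝ≥0 → Fin d → ℝ) (t : ℝ≥0) :
    Fin d → ℝ :=
  fun i => portfolioValue 𝕋 S π t * ratio π S t i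

theorem IsPortfolioStrategy.valueProcess_toTrading (hpos : ∀ t i, 0 < S t i)
    (h : IsPortfolioStrategy 𝕋 S π) :
    valueProcess S (toTrading 𝕋 S π) = portfolioValue 𝕋 S π := by
  funext t
  calc valueProcess S (toTrading 𝕋 S π) t = ∑ i, portfolioValue 𝕋 S π t * π t i := by
          rw [valueProcess, dotProduct]
          refine Finset.sum_congr rfl fun i _ => ?_
          rw [toTrading, ratio, mul_assoc, div_mul_cancel₀ _ (hpos t i).ne']
    _ = portfolioValue 𝕋 S π t := by rw [← Finset.mul_sum, (h.mem_simplex t).2, mul_one]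

theorem IsPortfolioStrategy.admissible_toTrading (hS : IsQVVec 𝕋 S) (hpos : ∀ t i, 0 < S t i)
    (h : IsPortfolioStrategy 𝕋 S π) : IsAdmissibleIntegrand S (toTrading 𝕋 S π) := by
  intro T hT
  have hL := hS.itoLogVec hpos
  obtain ⟨n, g, A, B, hg, hAc, hA, hBc, hB, hπ, hN⟩ := h.admissible.exists_ito hL hT
  set Z := follmerIntegral 𝕋 π (itoLogVec 𝕋 S) with hZdef
  have hZ : IsQV 𝕋 Z := h.isQV hS hpos
  have hgc : ContinuousOn (fun t => g (itoLogVec 𝕋 S t, A t) + B t) (Icc 0 T) :=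
    (hg.contDiffOn.continuousOn.comp (hL.continuous.continuousOn.prodMk hAc)
      fun _ _ => mem_univ _).add hBc
  set c₀ := g (itoLogVec 𝕋 S 0, A 0) + B 0 with hc₀
  have hZeq : ∀ t ≤ T, Z t = g (itoLogVec 𝕋 S t, A t) + B t - c₀ := fun t ht =>
    (tendsto_riemannSum hgc hN ht).limUnder_eq
  have hQ := hZ.sumsTo T
  -- The bounded variation terms, including ⟨Z⟩ / 2, go into the parameter b. Then V π / S is the
  -- gradient of exp(g(log x + c, a) + b), since exp reproduces the factor V.
  have hV : ∀ t ≤ T, portfolioValue 𝕋 S π t =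
      Real.exp (g (itoLogVec 𝕋 S t, A t) + (B t + (-c₀ + -2⁻¹ * quadVar 𝕋 Z t))) := by
    intro t ht
    rw [portfolioValue, doleansDade, ← hZdef, hZeq t ht]
    congr 1
    ring
  refine IsAdmissibleUpTo.of_reparam (κ := fun p => Real.log p.1 + p.2) (κ₁ := fun p => p.1⁻¹)
    (G := Real.exp) (G₁ := Real.exp) (X := itoLogVec 𝕋 S)
    (b := fun t => B t + (-c₀ + -2⁻¹ * quadVar 𝕋 Z t)) hg isOpen_Ioi isOpen_univ
    contDiffOn_log_add contDiffOn_inv_fst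
    (fun x hx c => (Real.hasDerivAt_log (ne_of_gt hx)).add_const c)
    Real.contDiff_exp.contDiffOn Real.contDiff_exp.contDiffOn
    (fun v _ => Real.hasDerivAt_exp v) hS.continuous.continuousOn hAc
    (hBc.add (continuousOn_const.add (continuousOn_const.mul hQ.cont)))
    (continuous_halfLogVar hS hpos).continuousOn hA
    (hB.add ((BoundedVariationOn.const _ _).add (hQ.boundedVariationOn.const_mul _)))
    (boundedVariationOn_halfLogVar hS hpos T) (fun t _ i => hpos t i) (fun t _ i => rfl)
    (fun _ _ => mem_univ _) fun t ht i => ?_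
  rw [toTrading, ratio, ← hV t ht, hπ t ht, div_eq_mul_inv, mul_assoc]

/-- For `ξ = V π / S`, the increments `V δ∫ π dℒ(S)` and `ξ · δS` agree up to a negligible
remainder. -/
theorem IsPortfolioStrategy.negl_mul_ratio (hS : IsQVVec 𝕋 S) (hpos : ∀ t i, 0 < S t i)
    (h : IsPortfolioStrategy 𝕋 S π) {V : ℝ≥0 → ℝ} (hV : Continuous V)
    (hξ : ∀ t i, ξ t i = V t * ratio π S t i) (T : ℝ≥0) :
    Negl 𝕋 (fun s u => V s * incr (follmerIntegral 𝕋 π (itoLogVec 𝕋 S)) s u -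
      dotIncr ξ S s u) T := by
  refine (((h.isIntegral_ratio hS hpos).negl T).mul hV.continuousOn).congr fun s u _ _ => ?_
  have : dotIncr ξ S s u = V s * dotIncr (ratio π S) S s u := by
    rw [dotIncr_eq_sum, dotIncr_eq_sum, Finset.mul_sum]
    exact Finset.sum_congr rfl fun i _ => by rw [hξ, mul_assoc]
  rw [this]
  ring

theorem IsPortfolioStrategy.isIntegral_toTrading (hS : IsQVVec 𝕋 S) (hpos : ∀ t i, 0 < S t i)
    (h : IsPortfolioStrategy 𝕋 S π) :
    IsIntegral 𝕋 (toTrading 𝕋 S π) S (portfolioValue 𝕋 S π) := by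
  have hZ := h.isQV hS hpos
  refine ⟨continuous_doleansDade hZ, fun T => ?_⟩
  exact ((negl_doleansDade hZ T).add (h.negl_mul_ratio hS hpos (continuous_doleansDade hZ)
    (fun _ _ => rfl) T)).congr fun s u _ _ => by
      simp only [portfolioValue]
      rw [sub_add_sub_cancel]
      rfl

theorem IsPortfolioStrategy.isPositiveLongOnly (hS : IsQVVec 𝕋 S) (hpos : ∀ t i, 0 < S t i)
    (h : IsPortfolioStrategy 𝕋 S π) : IsPositiveLongOnly 𝕋 S (toTrading 𝕋 S π) where
  selfFinancing :=
    ⟨h.admissible_toTrading hS hpos, fun t => by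
      rw [h.valueProcess_toTrading hpos, (h.isIntegral_toTrading hS hpos).follmerIntegral_eq]
      ring⟩
  noShortSales t i :=
    mul_nonneg (portfolioValue_pos t).le (div_nonneg ((h.mem_simplex t).1 i) (hpos t i).le)
  value_zero := by rw [h.valueProcess_toTrading hpos, portfolioValue_zero]
  value_pos t := by
    rw [h.valueProcess_toTrading hpos]
    exact portfolioValue_pos t

end Portfolio

/-! ### From trading strategies to portfolio strategies -/

section Trading

/-- The portfolio strategy that corresponds to a trading strategy. -/
noncomputable def toPortfolio (S ξ : ℝ≥0 → Fin d → ℝ) (t : ℝ≥0) : Fin d → ℝ :=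
  fun i => (valueProcess S ξ t)⁻¹ * ξ t i * S t i

theorem IsPositiveLongOnly.isIntegral (hS : IsQVVec 𝕋 S) (h : IsPositiveLongOnly 𝕋 S ξ) :
    IsIntegral 𝕋 ξ S (valueProcess S ξ) := by
  have hI := h.selfFinancing.admissible.isIntegral hS
  rw [funext h.selfFinancing.value_eq]
  exact ⟨continuous_const.add hI.continuous, fun T => (hI.negl T).congr fun s u _ _ => by
    simp only [incr, add_sub_add_left_eq_sub]⟩

theorem IsPositiveLongOnly.admissible_toPortfolio (hS : IsQVVec 𝕋 S) (hpos : ∀ t i, 0 < S t i)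
    (h : IsPositiveLongOnly 𝕋 S ξ) : IsAdmissibleIntegrand (itoLogVec 𝕋 S) (toPortfolio S ξ) := by
  intro T hT
  obtain ⟨n, f, A, B, hf, hAc, hA, hBc, hB, hξ, hN⟩ :=
    h.selfFinancing.admissible.exists_ito hS hT
  have hfc : ContinuousOn (fun t => f (S t, A t) + B t) (Icc 0 T) :=
    (hf.contDiffOn.continuousOn.comp (hS.continuous.continuousOn.prodMk hAc)
      fun _ _ => mem_univ _).add hBc
  -- The constant normalizes f(S, A) + B to the initial value V_0 = 1, so that it equals V. The
  -- outer logarithm then supplies 1 / V, and the derivative of exp(y - c) supplies the factor S.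
  set c₀ := 1 - (f (S 0, A 0) + B 0) with hc₀
  have hV : ∀ t ≤ T, f (S t, A t) + (B t + c₀) = valueProcess S ξ t := fun t ht => by
    rw [h.selfFinancing.value_eq, h.value_zero, show follmerIntegral 𝕋 ξ S t = _ from
      (tendsto_riemannSum hfc hN ht).limUnder_eq, hc₀]
    ring
  have hSL : ∀ t i, Real.exp (itoLogVec 𝕋 S t i - halfLogVar 𝕋 S t i) = S t i := fun t i => by
    rw [itoLogVec_apply, add_sub_cancel_right, Real.exp_log (hpos t i)]
  have hκ : ContDiffOn ℝ 1 (fun p : ℝ × ℝ => Real.exp (p.1 - p.2)) (univ ×ˢ univ) :=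
    (contDiff_fst.sub contDiff_snd).exp.contDiffOn
  refine IsAdmissibleUpTo.of_reparam (κ := fun p => Real.exp (p.1 - p.2))
    (κ₁ := fun p => Real.exp (p.1 - p.2))
    (G := Real.log) (G₁ := fun v => v⁻¹) (X := S) (I := univ) (J := Ioi 0)
    (b := fun t => B t + c₀) (c := halfLogVar 𝕋 S) hf isOpen_univ isOpen_Ioi hκ hκ
    (fun x _ c => by simpa using ((hasDerivAt_id x).sub_const c).exp)
    (contDiffOn_id.log fun _ hx => ne_of_gt hx) (contDiffOn_id.inv fun _ hx => ne_of_gt hx)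
    (fun v hv => Real.hasDerivAt_log (ne_of_gt hv)) (hS.itoLogVec hpos).continuous.continuousOn
    hAc (hBc.add continuousOn_const) (continuous_halfLogVar hS hpos).continuousOn hA
    (hB.add (.const _ _)) (boundedVariationOn_halfLogVar hS hpos T) (fun _ _ _ => mem_univ _)
    (fun t _ i => hSL t i) (fun t ht => ?_) fun t ht i => ?_
  · rw [hV t ht]
    exact h.value_pos t
  · rw [hV t ht, hSL, ← hξ t ht, toPortfolio]

theorem IsPositiveLongOnly.isPortfolioStrategy (hS : IsQVVec 𝕋 S) (hpos : ∀ t i, 0 < S t i)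
    (h : IsPositiveLongOnly 𝕋 S ξ) : IsPortfolioStrategy 𝕋 S (toPortfolio S ξ) where
  mem_simplex t := by
    refine ⟨fun i => mul_nonneg (mul_nonneg (inv_nonneg.2 (h.value_pos t).le)
      (h.noShortSales t i)) (hpos t i).le, ?_⟩
    simp only [toPortfolio, mul_assoc, ← Finset.mul_sum]
    exact inv_mul_cancel₀ (h.value_pos t).ne'
  admissible := h.admissible_toPortfolio hS hpos

theorem IsPositiveLongOnly.ratio_toPortfolio (hpos : ∀ t i, 0 < S t i) (t : ℝ≥0) (i : Fin d) :
    ratio (toPortfolio S ξ) S t i = (valueProcess S ξ t)⁻¹ * ξ t i := by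
  rw [ratio, toPortfolio, mul_div_cancel_right₀ _ (hpos t i).ne']

/-- With Z the integral of π along ℒ(S), self-financing gives δV ≈ ξ · δS ≈ V δZ. Uniqueness for
this equation identifies V with ℰ(Z), which is what makes `toTrading` recover ξ. -/
theorem IsPositiveLongOnly.portfolioValue_toPortfolio (hS : IsQVVec 𝕋 S)
    (hpos : ∀ t i, 0 < S t i) (h : IsPositiveLongOnly 𝕋 S ξ) :
    portfolioValue 𝕋 S (toPortfolio S ξ) = valueProcess S ξ := by
  funext t
  have hπ := h.isPortfolioStrategy hS hpos
  have hI := h.isIntegral hS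
  have hξc := h.selfFinancing.admissible.continuous hS.continuous
  have hN := ((hI.negl t).sub (hπ.negl_mul_ratio hS hpos (ξ := ξ) hI.continuous (fun t i => by
    rw [IsPositiveLongOnly.ratio_toPortfolio hpos,
      mul_inv_cancel_left₀ (h.value_pos t).ne']) t)).congr
    (Γ' := fun s u => incr (valueProcess S ξ) s u - valueProcess S ξ s *
      incr (follmerIntegral 𝕋 (toPortfolio S ξ) (itoLogVec 𝕋 S)) s u)
    fun s u _ _ => by ring
  have := log_eq_of_negl hI.continuous.continuousOn (fun s _ => h.value_pos s)
    ((hI.isQV hS hξc).sumsTo t).bdd (hπ.isQV hS hpos) hN le_rfl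
  rw [h.value_zero, Real.log_one, follmerIntegral_zero, sub_zero] at this
  rw [portfolioValue, doleansDade, ← Real.exp_log (h.value_pos t)]
  congr 1
  linarith

end Trading

/-- The correspondence between portfolio strategies and positive trading strategies. -/
noncomputable def strategyEquiv (hS : IsQVVec 𝕋 S) (hpos : ∀ t i, 0 < S t i) :
    {π : ℝ≥0 → Fin d → ℝ // IsPortfolioStrategy 𝕋 S π} ≃
      {ξ : ℝ≥0 → Fin d → ℝ // IsPositiveLongOnly 𝕋 S ξ} where
  toFun π := ⟨toTrading 𝕋 S π.1, π.2.isPositiveLongOnly hS hpos⟩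
  invFun ξ := ⟨toPortfolio S ξ.1, ξ.2.isPortfolioStrategy hS hpos⟩
  left_inv π := by
    ext t i
    simp only [toPortfolio]
    rw [π.2.valueProcess_toTrading hpos, toTrading,
      inv_mul_cancel_left₀ (portfolioValue_pos t).ne', ratio, div_mul_cancel₀ _ (hpos t i).ne']
  right_inv ξ := by
    ext t i
    simp only [toTrading]
    rw [ξ.2.portfolioValue_toPortfolio hS hpos, IsPositiveLongOnly.ratio_toPortfolio hpos,
      mul_inv_cancel_left₀ (ξ.2.value_pos t).ne']

end PathwiseIto

/-! ### The proposition -/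

theorem proposition2p1 {d : ℕ} (𝕋 : RefiningSequence) (S : ℝ≥0 → Fin d → ℝ)
    (hS : IsQVVec 𝕋 S) (hpos : ∀ t i, 0 < S t i) :
    (∀ i, IsQV 𝕋 (fun t => Real.log (S t i))) ∧
    IsQVVec 𝕋 (itoLogVec 𝕋 S) ∧
    ∃ e : {π : ℝ≥0 → Fin d → ℝ // IsPortfolioStrategy 𝕋 S π} ≃
        {ξ : ℝ≥0 → Fin d → ℝ // IsPositiveLongOnly 𝕋 S ξ},
      (∀ π ξ, e π = ξ ↔
        ∀ t, ratio π.1 S t = fun i => ξ.1 t i / valueProcess S ξ.1 t) ∧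
      ∀ π ξ, e π = ξ →
        FollmerIntegralExists 𝕋 ξ.1 S ∧
        FollmerIntegralExists 𝕋 π.1 (itoLogVec 𝕋 S) ∧
        IsQV 𝕋 (follmerIntegral 𝕋 π.1 (itoLogVec 𝕋 S)) ∧
        IsAdmissibleIntegrand S (ratio π.1 S) ∧
        FollmerIntegralExists 𝕋 (ratio π.1 S) S ∧
        IsQV 𝕋 (follmerIntegral 𝕋 (ratio π.1 S) S) ∧
        ∀ t, valueProcess S ξ.1 t = portfolioValue 𝕋 S π.1 t ∧
          portfolioValue 𝕋 S π.1 t =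
            doleansDade 𝕋 (follmerIntegral 𝕋 (ratio π.1 S) S) t := by
  refine ⟨hS.isQV_log hpos, hS.itoLogVec hpos, strategyEquiv hS hpos, fun π ξ => ?_,
    fun π ξ h => ?_⟩
  -- Passing to the inverse map makes the identity pointwise algebra, as `toPortfolio` involves no
  -- integral.
  · rw [← Equiv.eq_symm_apply, Subtype.ext_iff, funext_iff]
    refine forall_congr' fun t => ?_
    rw [funext_iff, funext_iff]
    refine forall_congr' fun i => ?_
    change π.1 t i = (valueProcess S ξ.1 t)⁻¹ * ξ.1 t i * S t i ↔ π.1 t i / S t i = _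
    rw [div_eq_iff (hpos t i).ne', div_eq_inv_mul]
  · subst h
    have hf := π.2.follmerIntegral_ratio hS hpos
    refine ⟨(π.2.isIntegral_toTrading hS hpos).exists_integral,
      (π.2.isIntegral hS hpos).exists_integral, π.2.isQV hS hpos, π.2.admissible_ratio hS hpos,
      (π.2.isIntegral_ratio hS hpos).exists_integral, hf ▸ π.2.isQV hS hpos, fun t => ⟨?_, ?_⟩⟩
    · exact congrFun (π.2.valueProcess_toTrading hpos) t
    · rw [hf]
      rfl
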